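/- Let $D$ be a separable unital $C^*$-algebra such that (i) $D$ is strongly self-absorbing: $D$ is not isomorphic to $\mathbb{C}$, and there are a $*$-isomorphism $\varphi : D \to D \otimes D$ (where $\otimes$ is the minimal $C^*$-tensor product) and a sequence $(u_n)_{n\in\mathbb{N}}$ of unitaries of $D \otimes D$ such that $\|u_n \varphi(d) u_n^* - d \otimes 1_D\| \to 0$ as $n \to \infty$ for every $d \in D$; and (ii) $D$ is $K_1$-injective: the canonical map $U(D)/U_0(D) \to K_1(D)$ is injective, where $U(D)$ is the unitary group of $D$ with the norm topology, $U_0(D)$ is the connected component of $1_D$ in $U(D)$, and $K_1(D) = \varinjlim_n U(M_n(D))/U_0(M_n(D))$ along the maps $u \mapsto \mathrm{diag}(u,1)$. Let $\mathrm{Aut}(D)$ be the group of $*$-automorphisms of $D$ with the point-norm topology, that is, the topology of pointwise norm convergence on $D$. Then $\mathrm{Aut}(D)$ is compactly contractible: for every compact Hausdorff space $X$, the set $[X, \mathrm{Aut}(D)]$ of homotopy classes of continuous maps $X \to \mathrm{Aut}(D)$ consists of exactly one point. -/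

import Mathlib

open scoped TensorProduct

universe u v

noncomputable section

/-- A unital `*`-representation of the C*-algebra `A` on a complex Hilbert space. The Hilbert spaces
range over the universe of `A`, which contains the GNS spaces of all states of `A` and hence a
faithful representation. -/
structure HilbertRep (A : Type u) [CStarAlgebra A] : Type (u + 1) where
  /-- the Hilbert space -/
  space : Type u
  [normedAddCommGroup : NormedAddCommGroup space]
  [innerProductSpace : InnerProductSpace ℂ space]
  [completeSpace : CompleteSpace space]
  /-- the representation -/
  rep : A →⋆ₐ[ℂ] (space →L[ℂ] space)

attribute [instance] HilbertRep.normedAddCommGroup HilbertRep.innerProductSpace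
  HilbertRep.completeSpace

section SpatialNorm

variable {A : Type u} {B : Type v} [CStarAlgebra A] [CStarAlgebra B]

/-- The representation `π ⊗ ρ` of the algebraic tensor product `A ⊗ B`, given by
`(π ⊗ ρ)(a ⊗ b) = π(a) ⊗ ρ(b)`, on the algebraic tensor product of the two Hilbert spaces with its
inner product. Bounded operators extend to the completion with the same norm, so the completion can
be left out. -/
def tensorRep (π : HilbertRep A) (ρ : HilbertRep B) :
    A ⊗[ℂ] B →ₐ[ℂ] ((π.space ⊗[ℂ] ρ.space) →L[ℂ] (π.space ⊗[ℂ] ρ.space)) :=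
  Algebra.TensorProduct.lift
    (AlgHom.ofLinearMap
      { toFun := fun a => TensorProduct.mapL (π.rep a) (1 : ρ.space →L[ℂ] ρ.space)
        map_add' := fun a b => by rw [map_add, TensorProduct.mapL_add_left]
        map_smul' := fun c a => by rw [map_smul, TensorProduct.mapL_smul_left]; rfl }
      (by
        change TensorProduct.mapL (π.rep 1) (1 : ρ.space →L[ℂ] ρ.space) = 1
        rw [map_one]
        exact TensorProduct.mapL_id_id)
      (fun a b => by
        change TensorProduct.mapL (π.rep (a * b)) (1 : ρ.space →L[ℂ] ρ.space) =
          TensorProduct.mapL (π.rep a) 1 * TensorProduct.mapL (π.rep b) 1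
        rw [map_mul, ← TensorProduct.mapL_mul, one_mul]))
    (AlgHom.ofLinearMap
      { toFun := fun b => TensorProduct.mapL (1 : π.space →L[ℂ] π.space) (ρ.rep b)
        map_add' := fun a b => by rw [map_add, TensorProduct.mapL_add_right]
        map_smul' := fun c a => by rw [map_smul, TensorProduct.mapL_smul_right]; rfl }
      (by
        change TensorProduct.mapL (1 : π.space →L[ℂ] π.space) (ρ.rep 1) = 1
        rw [map_one]
        exact TensorProduct.mapL_id_id)
      (fun a b => by
        change TensorProduct.mapL (1 : π.space →L[ℂ] π.space) (ρ.rep (a * b)) =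
          TensorProduct.mapL 1 (ρ.rep a) * TensorProduct.mapL 1 (ρ.rep b)
        rw [map_mul, ← TensorProduct.mapL_mul, one_mul]))
    (fun a b => by
      change TensorProduct.mapL (π.rep a) (1 : ρ.space →L[ℂ] ρ.space) *
          TensorProduct.mapL (1 : π.space →L[ℂ] π.space) (ρ.rep b) =
        TensorProduct.mapL (1 : π.space →L[ℂ] π.space) (ρ.rep b) *
          TensorProduct.mapL (π.rep a) (1 : ρ.space →L[ℂ] ρ.space)
      rw [← TensorProduct.mapL_mul, ← TensorProduct.mapL_mul, mul_one, one_mul, mul_one, one_mul])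

theorem tensorRep_tmul (π : HilbertRep A) (ρ : HilbertRep B) (a : A) (b : B) :
    tensorRep π ρ (a ⊗ₜ[ℂ] b) = TensorProduct.mapL (π.rep a) (ρ.rep b) := by
  change TensorProduct.mapL (π.rep a) (1 : ρ.space →L[ℂ] ρ.space) *
      TensorProduct.mapL (1 : π.space →L[ℂ] π.space) (ρ.rep b) = _
  rw [← TensorProduct.mapL_mul, mul_one, one_mul]

theorem inner_tensorRep_left (π : HilbertRep A) (ρ : HilbertRep B) (x : A ⊗[ℂ] B)
    (ξ η : π.space ⊗[ℂ] ρ.space) :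
    inner ℂ (tensorRep π ρ x ξ) η = inner ℂ ξ (tensorRep π ρ (star x) η) := by
  induction x with
  | zero => simp
  | add x y hx hy =>
    simp only [map_add, star_add, add_apply, inner_add_left, inner_add_right,
      hx, hy]
  | tmul a b =>
    rw [TensorProduct.star_tmul, tensorRep_tmul, tensorRep_tmul, map_star, map_star]
    induction ξ with
    | zero => simp
    | add ξ₁ ξ₂ h₁ h₂ => rw [map_add, inner_add_left, inner_add_left, h₁, h₂]
    | tmul h k =>
      induction η with
      | zero => simp
      | add η₁ η₂ h₁ h₂ => rw [map_add, inner_add_right, inner_add_right, h₁, h₂]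
      | tmul h' k' =>
        rw [TensorProduct.mapL_tmul, TensorProduct.mapL_tmul, TensorProduct.inner_tmul,
          TensorProduct.inner_tmul, ContinuousLinearMap.star_eq_adjoint,
          ContinuousLinearMap.star_eq_adjoint, ContinuousLinearMap.adjoint_inner_right,
          ContinuousLinearMap.adjoint_inner_right]

theorem tensorRep_norm_mul_self_le (π : HilbertRep A) (ρ : HilbertRep B) (x : A ⊗[ℂ] B) :
    ‖tensorRep π ρ x‖ * ‖tensorRep π ρ x‖ ≤ ‖tensorRep π ρ (star x * x)‖ := by
  have h0 : 0 ≤ ‖tensorRep π ρ (star x * x)‖ := ContinuousLinearMap.opNorm_nonneg _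
  have h : ‖tensorRep π ρ x‖ ≤ √‖tensorRep π ρ (star x * x)‖ := by
    refine ContinuousLinearMap.opNorm_le_bound _ (Real.sqrt_nonneg _) fun ξ => ?_
    rw [← Real.sqrt_sq (norm_nonneg ξ), ← Real.sqrt_mul h0]
    refine Real.le_sqrt_of_sq_le ?_
    rw [← inner_self_eq_norm_sq (𝕜 := ℂ), inner_tensorRep_left]
    refine (re_inner_le_norm (𝕜 := ℂ) ξ _).trans ?_
    have e : tensorRep π ρ (star x) (tensorRep π ρ x ξ) = tensorRep π ρ (star x * x) ξ := by
      rw [map_mul]; rfl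
    rw [e]
    calc ‖ξ‖ * ‖tensorRep π ρ (star x * x) ξ‖
        ≤ ‖ξ‖ * (‖tensorRep π ρ (star x * x)‖ * ‖ξ‖) := by
          gcongr; exact ContinuousLinearMap.le_opNorm _ _
      _ = _ := by ring
  calc _ ≤ √‖tensorRep π ρ (star x * x)‖ * √‖tensorRep π ρ (star x * x)‖ :=
        mul_le_mul h h (ContinuousLinearMap.opNorm_nonneg _) (Real.sqrt_nonneg _)
    _ = _ := Real.mul_self_sqrt h0

/-- The minimal (spatial) C*-norm on the algebraic tensor product of two C*-algebras:
`‖x‖ = sup ‖(π ⊗ ρ)(x)‖` over all representations `π` of `A` and `ρ` of `B`. -/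
def spatialNorm (x : A ⊗[ℂ] B) : ℝ :=
  ⨆ p : HilbertRep A × HilbertRep B, ‖tensorRep p.1 p.2 x‖

theorem spatialNorm_bddAbove (x : A ⊗[ℂ] B) :
    BddAbove (Set.range fun p : HilbertRep A × HilbertRep B => ‖tensorRep p.1 p.2 x‖) := by
  induction x with
  | zero =>
    refine ⟨0, ?_⟩
    rintro _ ⟨p, rfl⟩
    dsimp only
    rw [map_zero]
    exact ContinuousLinearMap.opNorm_zero.le
  | add x y hx hy =>
    obtain ⟨r, hr⟩ := hx
    obtain ⟨s, hs⟩ := hy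
    refine ⟨r + s, ?_⟩
    rintro _ ⟨p, rfl⟩
    dsimp only
    rw [map_add]
    exact (ContinuousLinearMap.opNorm_add_le _ _).trans (add_le_add (hr ⟨p, rfl⟩) (hs ⟨p, rfl⟩))
  | tmul a b =>
    refine ⟨‖a‖ * ‖b‖, ?_⟩
    rintro _ ⟨p, rfl⟩
    dsimp only
    rw [tensorRep_tmul]
    refine (TensorProduct.norm_mapL_le _ _).trans ?_
    gcongr
    · exact NonUnitalStarAlgHom.norm_apply_le p.1.rep a
    · exact NonUnitalStarAlgHom.norm_apply_le p.2.rep b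

theorem tensorRep_norm_le (p : HilbertRep A × HilbertRep B) (x : A ⊗[ℂ] B) :
    ‖tensorRep p.1 p.2 x‖ ≤ spatialNorm x :=
  le_ciSup (spatialNorm_bddAbove x) p

theorem spatialNorm_nonneg (x : A ⊗[ℂ] B) : 0 ≤ spatialNorm x :=
  Real.iSup_nonneg fun _ => ContinuousLinearMap.opNorm_nonneg _

theorem spatialNorm_mul_le (x y : A ⊗[ℂ] B) :
    spatialNorm (x * y) ≤ spatialNorm x * spatialNorm y := by
  refine Real.iSup_le (fun p => ?_) (mul_nonneg (spatialNorm_nonneg _) (spatialNorm_nonneg _))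
  rw [map_mul]
  exact (ContinuousLinearMap.opNorm_comp_le _ _).trans (mul_le_mul (tensorRep_norm_le p x)
    (tensorRep_norm_le p y) (ContinuousLinearMap.opNorm_nonneg _) (spatialNorm_nonneg _))

theorem spatialNorm_mul_self_le (x : A ⊗[ℂ] B) :
    spatialNorm x * spatialNorm x ≤ spatialNorm (star x * x) := by
  have h : spatialNorm x ≤ √(spatialNorm (star x * x)) :=
    Real.iSup_le (fun p => Real.le_sqrt_of_sq_le ((sq _).trans_le
      ((tensorRep_norm_mul_self_le p.1 p.2 x).trans (tensorRep_norm_le p _))))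
      (Real.sqrt_nonneg _)
  calc _ ≤ √(spatialNorm (star x * x)) * √(spatialNorm (star x * x)) :=
        mul_le_mul h h (spatialNorm_nonneg _) (Real.sqrt_nonneg _)
    _ = _ := Real.mul_self_sqrt (spatialNorm_nonneg _)

theorem spatialNorm_le_star (x : A ⊗[ℂ] B) : spatialNorm x ≤ spatialNorm (star x) := by
  have h := (spatialNorm_mul_self_le x).trans (spatialNorm_mul_le (star x) x)
  rcases (spatialNorm_nonneg x).eq_or_lt with h0 | h0
  · rw [← h0]; exact spatialNorm_nonneg _
  · exact le_of_mul_le_mul_right h h0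

theorem spatialNorm_star (x : A ⊗[ℂ] B) : spatialNorm (star x) = spatialNorm x :=
  le_antisymm (by simpa using spatialNorm_le_star (star x)) (spatialNorm_le_star x)

theorem spatialNorm_smul_le (c : ℂ) (x : A ⊗[ℂ] B) :
    spatialNorm (c • x) ≤ ‖c‖ * spatialNorm x := by
  refine Real.iSup_le (fun p => ?_) (mul_nonneg (norm_nonneg c) (spatialNorm_nonneg x))
  rw [map_smul]
  exact (ContinuousLinearMap.opNorm_smul_le c _).trans
    (mul_le_mul_of_nonneg_left (tensorRep_norm_le p x) (norm_nonneg c))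

variable (A B) in
/-- The spatial norm as a submultiplicative seminorm. (It is a norm, but this is not needed for
passing to the completion, which is always Hausdorff.) -/
def spatialSeminorm : RingSeminorm (A ⊗[ℂ] B) where
  toFun := spatialNorm
  map_zero' := le_antisymm (Real.iSup_le (fun p => by
    rw [map_zero]
    exact ContinuousLinearMap.opNorm_zero.le) le_rfl) (spatialNorm_nonneg _)
  add_le' x y := by
    refine Real.iSup_le (fun p => ?_) (add_nonneg (spatialNorm_nonneg _) (spatialNorm_nonneg _))
    rw [map_add]
    exact (ContinuousLinearMap.opNorm_add_le _ _).trans (add_le_add (tensorRep_norm_le p x) (tensorRep_norm_le p y))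
  neg' x := iSup_congr fun p => by
    rw [map_neg]
    exact ContinuousLinearMap.opNorm_neg _
  mul_le' := spatialNorm_mul_le

end SpatialNorm

/-- The algebraic tensor product `A ⊗ B` of two C*-algebras, as a type that carries the spatial
norm. -/
def AlgTensor (A : Type u) (B : Type v) [CStarAlgebra A] [CStarAlgebra B] : Type (max u v) :=
  A ⊗[ℂ] B

namespace AlgTensor

variable (A : Type u) (B : Type v) [CStarAlgebra A] [CStarAlgebra B]

instance : SeminormedRing (AlgTensor A B) := (spatialSeminorm A B).toSeminormedRing

instance : Algebra ℂ (AlgTensor A B) := inferInstanceAs (Algebra ℂ (A ⊗[ℂ] B))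

instance : StarRing (AlgTensor A B) := inferInstanceAs (StarRing (A ⊗[ℂ] B))

instance : StarModule ℂ (AlgTensor A B) := inferInstanceAs (StarModule ℂ (A ⊗[ℂ] B))

theorem norm_def (x : AlgTensor A B) : ‖x‖ = spatialNorm (A := A) (B := B) x := rfl

instance : NormedAlgebra ℂ (AlgTensor A B) where
  norm_smul_le c x := by
    exact spatialNorm_smul_le (A := A) (B := B) c x

instance : NormedStarGroup (AlgTensor A B) where
  norm_star_le x := (spatialNorm_star (A := A) (B := B) x).le

end AlgTensor

/-- The minimal (spatial) tensor product of two C*-algebras: the completion of the algebraic tensor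
product in the spatial norm. -/
def MinTensor (A : Type u) (B : Type v) [CStarAlgebra A] [CStarAlgebra B] : Type (max u v) :=
  UniformSpace.Completion (AlgTensor A B)

namespace MinTensor

variable {A : Type u} {B : Type v} [CStarAlgebra A] [CStarAlgebra B]

open UniformSpace

instance : NormedRing (MinTensor A B) :=
  inferInstanceAs (NormedRing (Completion (AlgTensor A B)))

instance : CompleteSpace (MinTensor A B) :=
  inferInstanceAs (CompleteSpace (Completion (AlgTensor A B)))

instance : Algebra ℂ (MinTensor A B) :=
  inferInstanceAs (Algebra ℂ (Completion (AlgTensor A B)))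

instance : NormedAlgebra ℂ (MinTensor A B) where
  norm_smul_le c x := norm_smul_le (β := Completion (AlgTensor A B)) c x

/-- The canonical map from the algebraic tensor product, as a plain function. -/
def coe (x : AlgTensor A B) : MinTensor A B := (x : Completion (AlgTensor A B))

theorem norm_coe (x : AlgTensor A B) : ‖coe x‖ = ‖x‖ := Completion.norm_coe x

theorem coe_add (x y : AlgTensor A B) : coe (x + y) = coe x + coe y := Completion.coe_add x y

theorem coe_mul (x y : AlgTensor A B) : coe (x * y) = coe x * coe y := Completion.coe_mul x y

theorem coe_one : coe (1 : AlgTensor A B) = 1 := Completion.coe_one _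

theorem coe_smul (c : ℂ) (x : AlgTensor A B) : coe (c • x) = c • coe x := Completion.coe_smul c x

theorem continuous_coe : Continuous (coe : AlgTensor A B → MinTensor A B) :=
  Completion.continuous_coe _

theorem denseRange_coe : DenseRange (coe : AlgTensor A B → MinTensor A B) :=
  Completion.denseRange_coe

/-- The involution, extended by continuity. -/
instance : Star (MinTensor A B) where
  star := Completion.map (star : AlgTensor A B → AlgTensor A B)

theorem uniformContinuous_star_algTensor :
    UniformContinuous (star : AlgTensor A B → AlgTensor A B) :=
  (starNormedAddGroupHom (E := AlgTensor A B)).uniformContinuous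

theorem coe_star (x : AlgTensor A B) : coe (star x) = star (coe x) :=
  (Completion.map_coe uniformContinuous_star_algTensor x).symm

theorem continuous_star' : Continuous (star : MinTensor A B → MinTensor A B) :=
  Completion.continuous_map

instance : StarRing (MinTensor A B) where
  star_involutive x := by
    refine denseRange_coe.induction_on x
      (isClosed_eq (continuous_star'.comp continuous_star') continuous_id) fun a => ?_
    rw [← coe_star, ← coe_star, star_star]
  star_mul x y := by
    refine denseRange_coe.induction_on₂
      (isClosed_eq (continuous_star'.comp continuous_mul)
        ((continuous_star'.comp continuous_snd).mul (continuous_star'.comp continuous_fst)))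
      (fun a b => ?_) x y
    rw [← coe_mul, ← coe_star, ← coe_star, ← coe_star, ← coe_mul, star_mul]
  star_add x y := by
    refine denseRange_coe.induction_on₂
      (isClosed_eq (continuous_star'.comp continuous_add)
        ((continuous_star'.comp continuous_fst).add (continuous_star'.comp continuous_snd)))
      (fun a b => ?_) x y
    rw [← coe_add, ← coe_star, ← coe_star, ← coe_star, ← coe_add, star_add]

instance : StarModule ℂ (MinTensor A B) where
  star_smul c x := by
    refine denseRange_coe.induction_on x
      (isClosed_eq (continuous_star'.comp (continuous_const_smul c))
        (continuous_star'.const_smul (star c))) fun a => ?_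
    rw [← coe_smul, ← coe_star, ← coe_star, ← coe_smul, star_smul]

instance : CStarRing (MinTensor A B) where
  norm_mul_self_le x := by
    refine denseRange_coe.induction_on x
      (isClosed_le (continuous_norm.mul continuous_norm)
        (continuous_norm.comp (continuous_star'.mul continuous_id))) fun a => ?_
    change ‖coe a‖ * ‖coe a‖ ≤ ‖star (coe a) * coe a‖
    rw [← coe_star, ← coe_mul, norm_coe, norm_coe]
    exact spatialNorm_mul_self_le (A := A) (B := B) a

instance : CStarAlgebra (MinTensor A B) where

/-- The canonical `*`-homomorphism from the algebraic tensor product to the minimal tensor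
product. -/
def ofTensor : A ⊗[ℂ] B →⋆ₐ[ℂ] MinTensor A B where
  toFun x := coe (A := A) (B := B) x
  map_one' := coe_one
  map_mul' := coe_mul
  map_zero' := Completion.coe_zero
  map_add' := coe_add
  commutes' c := by
    change coe (algebraMap ℂ (AlgTensor A B) c) = algebraMap ℂ (MinTensor A B) c
    rw [Algebra.algebraMap_eq_smul_one, Algebra.algebraMap_eq_smul_one, coe_smul, coe_one]
  map_star' := coe_star

/-- The `*`-homomorphism `id ⊗ 1 : A → A ⊗ B`, `a ↦ a ⊗ 1`. -/
def inclLeft (A : Type u) (B : Type v) [CStarAlgebra A] [CStarAlgebra B] :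
    A →⋆ₐ[ℂ] MinTensor A B where
  toFun a := ofTensor (a ⊗ₜ[ℂ] (1 : B))
  map_one' := map_one ofTensor
  map_mul' a b := by
    rw [← map_mul, Algebra.TensorProduct.tmul_mul_tmul, mul_one]
  map_zero' := by rw [TensorProduct.zero_tmul, map_zero]
  map_add' a b := by rw [TensorProduct.add_tmul, map_add]
  commutes' c := by
    rw [Algebra.algebraMap_eq_smul_one, Algebra.algebraMap_eq_smul_one, ← TensorProduct.smul_tmul',
      map_smul]
    exact congrArg (c • ·) (map_one ofTensor)
  map_star' a := by rw [← map_star, TensorProduct.star_tmul, star_one]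

end MinTensor
section ConnectedComponent

variable {G H : Type*} [Group G] [TopologicalSpace G] [IsTopologicalGroup G]
  [Group H] [TopologicalSpace H] [IsTopologicalGroup H]

instance connectedComponentOfOne_normal : (Subgroup.connectedComponentOfOne G).Normal where
  conj_mem n hn g := by
    have h := (show Continuous fun x : G => g * x * g⁻¹ by fun_prop).image_connectedComponent_subset
      (1 : G) ⟨n, hn, rfl⟩
    have h' : g * n * g⁻¹ ∈ connectedComponent (1 : G) := by simpa using h
    exact h'

/-- The group `π₀(G) = G / G₀` of connected components of a topological group. -/
abbrev ComponentGroup (G : Type*) [Group G] [TopologicalSpace G] [IsTopologicalGroup G] : Type _ :=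
  G ⧸ Subgroup.connectedComponentOfOne G

/-- The homomorphism `G / G₀ → H / H₀` induced by a continuous homomorphism `G → H`. -/
def ComponentGroup.map (f : G →* H) (hf : Continuous f) : ComponentGroup G →* ComponentGroup H :=
  QuotientGroup.map _ _ f fun x hx => by
    have h := hf.image_connectedComponent_subset (1 : G) ⟨x, hx, rfl⟩
    rwa [map_one] at h

end ConnectedComponent

section KOne

variable (A : Type u) [CStarAlgebra A]

/-- The group `U_n(A)` of unitary `n × n` matrices over `A`. Its topology is that of entrywise
convergence, which is the norm topology of the C*-algebra `M_n(A)`. -/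
abbrev UnitaryMatrix (n : ℕ) : Type u := unitary (Matrix (Fin n) (Fin n) A)

variable {A}

/-- The matrix `diag(M, 1)` of size `m ≥ n` for a matrix `M` of size `n`. -/
def padMatrix {n m : ℕ} (M : Matrix (Fin n) (Fin n) A) : Matrix (Fin m) (Fin m) A :=
  Matrix.of fun i j =>
    if h : (i : ℕ) < n ∧ (j : ℕ) < n then M ⟨i, h.1⟩ ⟨j, h.2⟩ else if i = j then 1 else 0

theorem padMatrix_one {n m : ℕ} : padMatrix (m := m) (1 : Matrix (Fin n) (Fin n) A) = 1 := by
  ext i j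
  simp only [padMatrix, Matrix.of_apply, Matrix.one_apply, Fin.ext_iff]
  split_ifs <;> rfl

theorem padMatrix_star {n m : ℕ} (M : Matrix (Fin n) (Fin n) A) :
    padMatrix (m := m) (star M) = star (padMatrix M) := by
  ext i j
  simp only [padMatrix, Matrix.of_apply, Matrix.star_apply]
  by_cases h : (i : ℕ) < n ∧ (j : ℕ) < n
  · rw [dif_pos h, dif_pos h.symm]
  · rw [dif_neg h, dif_neg (fun h' => h h'.symm)]
    by_cases e : i = j
    · simp [e]
    · simp [e, Ne.symm e]

theorem padMatrix_mul {n m : ℕ} (hnm : n ≤ m) (M N : Matrix (Fin n) (Fin n) A) :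
    padMatrix (m := m) (M * N) = padMatrix M * padMatrix N := by
  obtain ⟨k, rfl⟩ := Nat.exists_eq_add_of_le hnm
  have h₁ (x : Fin k) (y : Fin n) : ¬ n + (x : ℕ) = y := by omega
  have h₂ (x : Fin k) (y : Fin n) : ¬ (y : ℕ) = n + x := by omega
  ext i j
  rw [Matrix.mul_apply, Fin.sum_univ_add]
  refine Fin.addCases (fun i => ?_) (fun i => ?_) i <;>
  refine Fin.addCases (fun j => ?_) (fun j => ?_) j
  all_goals simp [padMatrix, Matrix.mul_apply, Fin.ext_iff, h₁, h₂]
  all_goals simp [Fin.val_inj]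

theorem continuous_padMatrix {n m : ℕ} :
    Continuous (padMatrix : Matrix (Fin n) (Fin n) A → Matrix (Fin m) (Fin m) A) := by
  refine continuous_matrix fun i j => ?_
  by_cases h : (i : ℕ) < n ∧ (j : ℕ) < n
  · simp only [padMatrix, Matrix.of_apply, dif_pos h]
    exact continuous_id.matrix_elem _ _
  · simp only [padMatrix, Matrix.of_apply, dif_neg h]
    exact continuous_const

/-- The connecting homomorphism `U_n(A) → U_m(A)`, `u ↦ diag(u, 1)`, for `n ≤ m`. -/
def padUnitary {n m : ℕ} (h : n ≤ m) : UnitaryMatrix A n →* UnitaryMatrix A m :=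
  (Unitary.map
    { toFun := padMatrix
      map_one' := padMatrix_one
      map_mul' := padMatrix_mul h
      map_star' := padMatrix_star } :
    unitary (Matrix (Fin n) (Fin n) A) →⋆* unitary (Matrix (Fin m) (Fin m) A)).toMonoidHom

theorem continuous_padUnitary {n m : ℕ} (h : n ≤ m) :
    Continuous (padUnitary (A := A) h) :=
  (continuous_padMatrix.comp continuous_subtype_val).subtype_mk _

/-- The connecting homomorphism `U_n(A) / U_n(A)₀ → U_m(A) / U_m(A)₀` for `n ≤ m`. -/
def kOneMap (n m : ℕ) (h : n ≤ m) :
    ComponentGroup (UnitaryMatrix A n) →* ComponentGroup (UnitaryMatrix A m) :=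
  ComponentGroup.map (padUnitary h) (continuous_padUnitary h)

instance kOne_directedSystem :
    DirectedSystem (fun n => ComponentGroup (UnitaryMatrix A n))
      fun n m h => (kOneMap (A := A) n m h) where
  map_self n x := by
    induction x using QuotientGroup.induction_on with
    | H u =>
      refine congrArg QuotientGroup.mk (Subtype.ext (Matrix.ext fun i j => ?_))
      change padMatrix (u : Matrix (Fin n) (Fin n) A) i j = _
      simp [padMatrix]
  map_map k m n hnm hmk x := by
    induction x using QuotientGroup.induction_on with
    | H u =>
      refine congrArg QuotientGroup.mk (Subtype.ext (Matrix.ext fun i j => ?_))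
      change padMatrix (padMatrix (u : Matrix (Fin n) (Fin n) A)) i j =
        padMatrix (u : Matrix (Fin n) (Fin n) A) i j
      simp only [padMatrix, Matrix.of_apply, Fin.ext_iff]
      split_ifs <;> first | rfl | omega

variable (A)

/-- The group `K₁(A)`, the direct limit of the groups `U_n(A) / U_n(A)₀` along `u ↦ diag(u, 1)`. -/
def KOne : Type u :=
  DirectLimit (fun n => ComponentGroup (UnitaryMatrix A n)) (fun n m h => kOneMap (A := A) n m h)

instance : Group (KOne A) :=
  inferInstanceAs (Group (DirectLimit (fun n => ComponentGroup (UnitaryMatrix A n))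
    (fun n m h => kOneMap (A := A) n m h)))

/-- The identification of `U(A)` with `U_1(A)`. -/
def unitaryToMatrix : unitary A →* UnitaryMatrix A 1 :=
  (Unitary.map
    { toFun := fun a => Matrix.of fun _ _ : Fin 1 => a
      map_one' := by ext i j; simp [Matrix.one_apply, Subsingleton.elim i j]
      map_mul' := fun a b => by ext i j; simp [Matrix.mul_apply]
      map_star' := fun a => by ext i j; simp } :
    unitary A →⋆* unitary (Matrix (Fin 1) (Fin 1) A)).toMonoidHom

theorem continuous_unitaryToMatrix : Continuous (unitaryToMatrix A) :=
  Continuous.subtype_mk (continuous_matrix fun _ _ => continuous_subtype_val) _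

/-- The canonical homomorphism `U(A) / U₀(A) → K₁(A)`. -/
def toKOne : ComponentGroup (unitary A) →* KOne A where
  toFun x := (⟦⟨1, ComponentGroup.map (unitaryToMatrix A) (continuous_unitaryToMatrix A) x⟩⟧ :
    DirectLimit (fun n => ComponentGroup (UnitaryMatrix A n))
      (fun n m h => kOneMap (A := A) n m h))
  map_one' := by
    rw [map_one]
    exact (DirectLimit.one_def (f := fun n m h => kOneMap (A := A) n m h) 1).symm
  map_mul' x y := by
    rw [map_mul]
    exact (DirectLimit.mul_def (f := fun n m h => kOneMap (A := A) n m h) 1 _ _).symm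

/-- `A` is `K₁`-injective if the canonical map `U(A) / U₀(A) → K₁(A)` is injective. -/
def IsKOneInjective : Prop := Function.Injective (toKOne A)

end KOne

section StronglySelfAbsorbing

open Filter Topology

/-- Unital `*`-homomorphisms `σ, γ : A → B` are approximately unitarily equivalent if there is a
sequence of unitaries `u n` in `B` with `‖u n * σ a * (u n)* - γ a‖ → 0` for every `a`. -/
def ApproxUnitarilyEquiv {A : Type u} {B : Type v} [CStarAlgebra A] [CStarAlgebra B]
    (σ γ : A →⋆ₐ[ℂ] B) : Prop :=
  ∃ w : ℕ → unitary B, ∀ a : A,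
    Tendsto (fun n => ‖(w n : B) * σ a * star (w n : B) - γ a‖) atTop (𝓝 0)

/-- A separable unital C*-algebra `D` is strongly self-absorbing if `D ≠ ℂ` and there is an
isomorphism `φ : D → D ⊗ D` that is approximately unitarily equivalent to `d ↦ d ⊗ 1`. -/
structure IsStronglySelfAbsorbing (D : Type u) [CStarAlgebra D] : Prop where
  separable : TopologicalSpace.SeparableSpace D
  not_complex : IsEmpty (D ≃⋆ₐ[ℂ] ℂ)
  exists_iso : ∃ φ : D ≃⋆ₐ[ℂ] MinTensor D D,
    ApproxUnitarilyEquiv (φ : D →⋆ₐ[ℂ] MinTensor D D) (MinTensor.inclLeft D D)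

end StronglySelfAbsorbing

/-- The group `Aut(A)` of `*`-automorphisms of a C*-algebra. -/
def CStarAut (A : Type u) [CStarAlgebra A] : Type u := A ≃⋆ₐ[ℂ] A

/-- The point-norm topology on `Aut(A)`: the topology of pointwise convergence in norm. -/
instance CStarAut.instTopologicalSpace (A : Type u) [CStarAlgebra A] :
    TopologicalSpace (CStarAut A) :=
  TopologicalSpace.induced (fun (φ : A ≃⋆ₐ[ℂ] A) (a : A) => φ a) Pi.topologicalSpace

/-- The set `[X, Y]` of homotopy classes of continuous maps from `X` to `Y`. -/
def HomotopyClasses (X : Type v) (Y : Type u) [TopologicalSpace X] [TopologicalSpace Y] :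
    Type (max u v) :=
  Quotient (⟨ContinuousMap.Homotopic, ContinuousMap.Homotopic.equivalence⟩ : Setoid C(X, Y))

end

/-!
Write `Ad u` for the inner automorphism `x ↦ u x u*` and fix an isomorphism `D ≅ D ⊗ D`, viewed inside
`D` as a pair of commuting endomorphisms `left : d ↦ d ⊗ 1` and `right : d ↦ 1 ⊗ d` (`SelfTensor`).
All homotopy classes coincide because `Aut(D)` itself is contractible (`homotopic_id_const_cstarAut`).

Suppose that `Y t` and `V t` are rays of unitaries, starting at `1`, such that `Ad (Y t)` carries
`d ⊗ 1` to `d` asymptotically and `Ad (V t)` carries `1 ⊗ d` to `d`. For an automorphism `α`, asymptotically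
`Y t*` carries `α d` to `α d ⊗ 1 = (α ⊗ id) (d ⊗ 1)`, then `(α ⊗ id) (V t* Y t)` carries this to
`(α ⊗ id) (1 ⊗ d) = 1 ⊗ d`, and `V t` carries that to `d`. So conjugation by the product of these three
unitaries (`SelfTensor.untwist`) deforms `α` to the identity, and the deformation is jointly continuous
in `t` and `α`, also at the end of the ray (`SelfTensor.norm_innerAut_untwist_sub_le`).

The rays are found by making every unital endomorphism of `D` asymptotically inner
(`SelfTensor.exists_unitary_ray`), in four steps.

* Every unital endomorphism is approximately inner (`SelfTensor.approxEquiv_id`), by a computation in the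
  monoid of endomorphisms modulo approximate unitary equivalence.
* The implementing unitaries may be taken in the component of `1`
  (`SelfTensor.exists_mem_component_innerAut_near`): replace `v` by `v ⊗ v*`, which is close to a
  commutator. Commutators vanish in `K₁`, so `K₁`-injectivity puts them into the component of `1`
  (`commutator_mem_connectedComponentOfOne`).
* A unitary in the component of `1` that approximately commutes with a large finite set is joined to `1`
  by unitaries that approximately commute with a given finite set
  (`SelfTensor.exists_joinedIn_approxCentral`): conjugate a path of the form `u s ⊗ 1`, which commutes with
  `1 ⊗ D`, by a unitary that approximately exchanges the two factors.
* By separability a sequence of implementing unitaries can be chosen whose consecutive quotients fall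
  under the previous step, and the resulting paths are concatenated (`exists_ray_of_joinedIn`).
-/

noncomputable section

/-! ### Functoriality of the spatial norm -/

section Functoriality

variable {A A' : Type u} {B B' : Type v} [CStarAlgebra A] [CStarAlgebra A'] [CStarAlgebra B]
  [CStarAlgebra B']

/-- The restriction of a representation of `A'` along a unital `*`-homomorphism `A → A'`. -/
def HilbertRep.comp (π : HilbertRep A') (α : A →⋆ₐ[ℂ] A') : HilbertRep A where
  space := π.space
  rep := π.rep.comp α

theorem tensorRep_map (π : HilbertRep A') (ρ : HilbertRep B') (α : A →⋆ₐ[ℂ] A') (β : B →⋆ₐ[ℂ] B')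
    (x : A ⊗[ℂ] B) :
    tensorRep π ρ (Algebra.TensorProduct.map (α : A →ₐ[ℂ] A') (β : B →ₐ[ℂ] B') x) =
      tensorRep (π.comp α) (ρ.comp β) x := by
  induction x with
  | zero => simp only [map_zero]; rfl
  | add x y hx hy => simp only [map_add, hx, hy]; rfl
  | tmul a b => rw [Algebra.TensorProduct.map_tmul, tensorRep_tmul, tensorRep_tmul]; rfl

theorem spatialNorm_map_le (α : A →⋆ₐ[ℂ] A') (β : B →⋆ₐ[ℂ] B') (x : A ⊗[ℂ] B) :
    spatialNorm (Algebra.TensorProduct.map (α : A →ₐ[ℂ] A') (β : B →ₐ[ℂ] B') x) ≤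
      spatialNorm x := by
  refine Real.iSup_le (fun p => ?_) (spatialNorm_nonneg x)
  rw [tensorRep_map]
  exact tensorRep_norm_le (p.1.comp α, p.2.comp β) x

theorem tensorRep_comm_apply (π : HilbertRep A) (ρ : HilbertRep B) (x : A ⊗[ℂ] B)
    (ξ : ρ.space ⊗[ℂ] π.space) :
    tensorRep ρ π (Algebra.TensorProduct.comm ℂ A B x) ξ =
      TensorProduct.comm ℂ _ _ (tensorRep π ρ x (TensorProduct.comm ℂ _ _ ξ)) := by
  induction x with
  | zero => simp
  | add x y hx hy => simp only [map_add, add_apply, hx, hy]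
  | tmul a b =>
    rw [Algebra.TensorProduct.comm_tmul, tensorRep_tmul, tensorRep_tmul]
    induction ξ with
    | zero => simp
    | add ξ η hξ hη => simp only [map_add, hξ, hη]
    | tmul h k => simp only [TensorProduct.mapL_tmul, TensorProduct.comm_tmul]

theorem spatialNorm_comm_le (x : A ⊗[ℂ] B) :
    spatialNorm (Algebra.TensorProduct.comm ℂ A B x) ≤ spatialNorm x := by
  refine Real.iSup_le (fun p => ?_) (spatialNorm_nonneg x)
  refine le_trans ?_ (tensorRep_norm_le (p.2, p.1) x)
  refine ContinuousLinearMap.opNorm_le_bound _ (ContinuousLinearMap.opNorm_nonneg _) fun ξ => ?_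
  rw [tensorRep_comm_apply, TensorProduct.norm_comm]
  refine (ContinuousLinearMap.le_opNorm _ _).trans_eq ?_
  rw [TensorProduct.norm_comm]

end Functoriality

/-! ### Homomorphisms of minimal tensor products -/

namespace MinTensor

open UniformSpace

section Extend

variable {A A' : Type*} {B B' : Type*} [CStarAlgebra A] [CStarAlgebra A'] [CStarAlgebra B]
  [CStarAlgebra B']

theorem denseRange_ofTensor : DenseRange (ofTensor : A ⊗[ℂ] B →⋆ₐ[ℂ] MinTensor A B) :=
  denseRange_coe

/-- A homomorphism of algebraic tensor products preserves the involution as soon as it does so on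
elementary tensors. -/
theorem map_star_of_tmul (f : A ⊗[ℂ] B →ₐ[ℂ] A' ⊗[ℂ] B')
    (h : ∀ a b, f (star (a ⊗ₜ[ℂ] b)) = star (f (a ⊗ₜ[ℂ] b))) (x : A ⊗[ℂ] B) :
    f (star x) = star (f x) := by
  induction x with
  | zero => simp
  | add x y hx hy => rw [star_add, map_add, map_add, star_add, hx, hy]
  | tmul a b => exact h a b

variable (f : A ⊗[ℂ] B →ₐ[ℂ] A' ⊗[ℂ] B')

/-- The extension by continuity of an algebra homomorphism of algebraic tensor products, as a plain
function; it is meaningful when the homomorphism is contractive for the spatial norms. -/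
def extendFun : MinTensor A B → MinTensor A' B' :=
  Completion.map (fun x : AlgTensor A B => (f x : AlgTensor A' B'))

theorem continuous_extendFun : Continuous (extendFun f) := Completion.continuous_map

variable {f}

theorem extendFun_coe (hf : ∀ x, spatialNorm (f x) ≤ spatialNorm x) (x : A ⊗[ℂ] B) :
    extendFun f (coe (A := A) (B := B) x) = coe (A := A') (B := B') (f x) := by
  let g : AlgTensor A B →+ AlgTensor A' B' := f.toRingHom.toAddMonoidHom
  have hg : Continuous g :=
    AddMonoidHomClass.continuous_of_bound g 1 fun x => by rw [one_mul]; exact hf x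
  exact Completion.map_coe (uniformContinuous_addMonoidHom_of_continuous hg) x

/-- The extension to the minimal tensor products of a `*`-homomorphism of algebraic tensor products
that is contractive for the spatial norms. -/
def extend (hs : ∀ x, f (star x) = star (f x))
    (hf : ∀ x, spatialNorm (f x) ≤ spatialNorm x) : MinTensor A B →⋆ₐ[ℂ] MinTensor A' B' where
  toFun := extendFun f
  map_one' := by
    refine (congrArg _ (map_one (ofTensor (A := A) (B := B))).symm).trans ?_
    refine (extendFun_coe hf 1).trans ?_
    rw [map_one]
    exact map_one (ofTensor (A := A') (B := B'))
  map_zero' := by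
    refine (congrArg _ (map_zero (ofTensor (A := A) (B := B))).symm).trans ?_
    refine (extendFun_coe hf 0).trans ?_
    rw [map_zero]
    exact map_zero (ofTensor (A := A') (B := B'))
  map_mul' x y := by
    refine denseRange_ofTensor.induction_on₂ (isClosed_eq
      ((continuous_extendFun f).comp continuous_mul)
      (((continuous_extendFun f).comp continuous_fst).mul
        ((continuous_extendFun f).comp continuous_snd))) (fun a b => ?_) x y
    rw [← map_mul]
    refine (extendFun_coe hf _).trans ?_
    rw [map_mul]
    refine (map_mul (ofTensor (A := A') (B := B')) _ _).trans ?_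
    exact (congrArg₂ _ (extendFun_coe hf a) (extendFun_coe hf b)).symm
  map_add' x y := by
    refine denseRange_ofTensor.induction_on₂ (isClosed_eq
      ((continuous_extendFun f).comp continuous_add)
      (((continuous_extendFun f).comp continuous_fst).add
        ((continuous_extendFun f).comp continuous_snd))) (fun a b => ?_) x y
    rw [← map_add]
    refine (extendFun_coe hf _).trans ?_
    rw [map_add]
    refine (map_add (ofTensor (A := A') (B := B')) _ _).trans ?_
    exact (congrArg₂ _ (extendFun_coe hf a) (extendFun_coe hf b)).symm
  commutes' c := by
    refine (congrArg _ (AlgHomClass.commutes (ofTensor (A := A) (B := B)) c).symm).trans ?_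
    refine (extendFun_coe hf _).trans ?_
    rw [AlgHom.commutes]
    exact AlgHomClass.commutes (ofTensor (A := A') (B := B')) c
  map_star' x := by
    refine denseRange_ofTensor.induction_on x (isClosed_eq
      ((continuous_extendFun f).comp continuous_star')
      (continuous_star'.comp (continuous_extendFun f))) fun a => ?_
    rw [← map_star]
    refine (extendFun_coe hf _).trans ?_
    rw [hs]
    refine (map_star (ofTensor (A := A') (B := B')) _).trans ?_
    exact (congrArg star (extendFun_coe hf a)).symm

theorem extend_ofTensor (hs : ∀ x, f (star x) = star (f x))
    (hf : ∀ x, spatialNorm (f x) ≤ spatialNorm x) (x : A ⊗[ℂ] B) :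
    extend hs hf (ofTensor x) = ofTensor (f x) :=
  extendFun_coe hf x

end Extend

variable {A A' : Type u} {B B' : Type v} [CStarAlgebra A] [CStarAlgebra A'] [CStarAlgebra B]
  [CStarAlgebra B']

/-- The tensor product `α ⊗ β : A ⊗ B → A' ⊗ B'` of two unital `*`-homomorphisms. -/
def map (α : A →⋆ₐ[ℂ] A') (β : B →⋆ₐ[ℂ] B') : MinTensor A B →⋆ₐ[ℂ] MinTensor A' B' :=
  extend (f := Algebra.TensorProduct.map (α : A →ₐ[ℂ] A') (β : B →ₐ[ℂ] B'))
    (map_star_of_tmul _ fun a b => by simp [TensorProduct.star_tmul, map_star])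
    (spatialNorm_map_le α β)

theorem map_tmul (α : A →⋆ₐ[ℂ] A') (β : B →⋆ₐ[ℂ] B') (a : A) (b : B) :
    map α β (ofTensor (a ⊗ₜ b)) = ofTensor (α a ⊗ₜ β b) :=
  extend_ofTensor _ _ _

variable (A B) in
/-- The flip `A ⊗ B → B ⊗ A`. -/
def flip : MinTensor A B →⋆ₐ[ℂ] MinTensor B A :=
  extend (f := (Algebra.TensorProduct.comm ℂ A B : A ⊗[ℂ] B →ₐ[ℂ] B ⊗[ℂ] A))
    (map_star_of_tmul _ fun a b => by simp [TensorProduct.star_tmul])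
    spatialNorm_comm_le

theorem flip_tmul (a : A) (b : B) : flip A B (ofTensor (a ⊗ₜ b)) = ofTensor (b ⊗ₜ a) :=
  extend_ofTensor _ _ _

end MinTensor

/-! ### Inner automorphisms -/

section InnerAutomorphisms

variable {A B : Type*} [CStarAlgebra A] [CStarAlgebra B]

/-- The inner automorphism `x ↦ u x u*`. -/
abbrev innerAut (u : unitary A) : A ≃⋆ₐ[ℂ] A := Unitary.conjStarAlgAut ℂ A u

/-- The homomorphism of unitary groups induced by a unital `*`-homomorphism. -/
def unitaryMap (f : A →⋆ₐ[ℂ] B) : unitary A →* unitary B :=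
  (Unitary.map
    { toFun := f
      map_one' := map_one f
      map_mul' := map_mul f
      map_star' := map_star f } : unitary A →⋆* unitary B).toMonoidHom

theorem continuous_starAlgHom (f : A →⋆ₐ[ℂ] B) : Continuous f :=
  AddMonoidHomClass.continuous_of_bound f 1 fun x => by
    rw [one_mul]; exact NonUnitalStarAlgHom.norm_apply_le f x

theorem norm_starAlgHom_sub_le (f : A →⋆ₐ[ℂ] B) (x y : A) : ‖f x - f y‖ ≤ ‖x - y‖ := by
  rw [← map_sub]; exact NonUnitalStarAlgHom.norm_apply_le f _

theorem norm_starAlgEquiv_sub (f : A ≃⋆ₐ[ℂ] B) (x y : A) : ‖f x - f y‖ = ‖x - y‖ := by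
  rw [← map_sub]; exact NonUnitalStarAlgHom.norm_map f f.injective _

theorem coe_unitaryMap (f : A →⋆ₐ[ℂ] B) (u : unitary A) : (unitaryMap f u : B) = f u := rfl

theorem continuous_unitaryMap (f : A →⋆ₐ[ℂ] B) : Continuous (unitaryMap f) :=
  ((continuous_starAlgHom f).comp continuous_subtype_val).subtype_mk _

theorem map_innerAut (f : A →⋆ₐ[ℂ] B) (u : unitary A) (x : A) :
    f (innerAut u x) = innerAut (unitaryMap f u) (f x) := by
  simp only [Unitary.conjStarAlgAut_apply, map_mul, map_star, coe_unitaryMap]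

theorem innerAut_mul_apply (u v : unitary A) (x : A) :
    innerAut (u * v) x = innerAut u (innerAut v x) :=
  Unitary.conjStarAlgAut_mul_apply u v x

theorem innerAut_one_apply (x : A) : innerAut (1 : unitary A) x = x := by
  simp only [map_one]; rfl

theorem innerAut_innerAut_inv (u : unitary A) (x : A) : innerAut u (innerAut u⁻¹ x) = x := by
  rw [← innerAut_mul_apply, mul_inv_cancel, innerAut_one_apply]

theorem norm_innerAut_inv_sub (u : unitary A) (x y : A) :
    ‖innerAut u⁻¹ x - y‖ = ‖innerAut u y - x‖ := by
  rw [← norm_starAlgEquiv_sub (innerAut u), innerAut_innerAut_inv, norm_sub_rev]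

theorem innerAut_eq_of_commute {u : unitary A} {x : A} (h : Commute (u : A) x) :
    innerAut u x = x := by
  rw [Unitary.conjStarAlgAut_apply, h.eq, mul_assoc, Unitary.mul_star_self_of_mem u.2, mul_one]

/-- The commutator with a unitary has the same norm as the displacement under conjugation. -/
theorem norm_innerAut_sub_self (u : unitary A) (x : A) :
    ‖innerAut u x - x‖ = ‖(u : A) * x - x * u‖ := by
  rw [← CStarRing.norm_mul_coe_unitary (innerAut u x - x) u, Unitary.conjStarAlgAut_apply, sub_mul,
    mul_assoc, Unitary.coe_star_mul_self, mul_one]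

theorem norm_innerAut_sub_innerAut_le (u v : unitary A) (x : A) :
    ‖innerAut u x - innerAut v x‖ ≤ 2 * ‖(u : A) - v‖ * ‖x‖ := by
  have e : innerAut u x - innerAut v x =
      ((u : A) - v) * (x * star (u : A)) + (v : A) * x * star ((u : A) - v) := by
    simp only [Unitary.conjStarAlgAut_apply, star_sub]
    noncomm_ring
  have h1 : ‖x * star (u : A)‖ = ‖x‖ := CStarRing.norm_mul_coe_unitary x (star u)
  have h2 : ‖(v : A) * x‖ = ‖x‖ := CStarRing.norm_coe_unitary_mul v x
  rw [e]
  refine (norm_add_le _ _).trans ?_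
  have h3 := norm_mul_le ((u : A) - v) (x * star (u : A))
  have h4 := norm_mul_le ((v : A) * x) (star ((u : A) - v))
  rw [h1] at h3
  rw [h2, norm_star] at h4
  linarith

theorem continuous_innerAut_apply {X : Type*} [TopologicalSpace X] {u : X → unitary A} {f : X → A}
    (hu : Continuous u) (hf : Continuous f) : Continuous fun t => innerAut (u t) (f t) := by
  simp only [Unitary.conjStarAlgAut_apply]
  have h := continuous_subtype_val.comp hu
  exact (h.mul hf).mul h.star

theorem norm_innerAut_sub_le_add {u : unitary A} {x y z : A} :
    ‖innerAut u x - z‖ ≤ ‖x - y‖ + ‖innerAut u y - z‖ := by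
  rw [← norm_starAlgEquiv_sub (innerAut u) x y]
  exact norm_sub_le_norm_sub_add_norm_sub _ _ _

/-- Pointwise convergence of contractive maps may be tested on a dense set. -/
theorem tendsto_of_dense {ι : Type*} {l : Filter ι} {f : ι → A → B} {g : A → B} {s : Set A}
    (hf : ∀ i x y, ‖f i x - f i y‖ ≤ ‖x - y‖) (hg : ∀ x y, ‖g x - g y‖ ≤ ‖x - y‖) (hs : Dense s)
    (h : ∀ x ∈ s, Filter.Tendsto (fun i => f i x) l (nhds (g x))) (x : A) :
    Filter.Tendsto (fun i => f i x) l (nhds (g x)) := by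
  rw [Metric.tendsto_nhds]
  intro ε hε
  obtain ⟨y, hy, hys⟩ := Metric.dense_iff.1 hs x (ε / 3) (by positivity)
  rw [Metric.mem_ball, dist_eq_norm] at hy
  filter_upwards [Metric.tendsto_nhds.1 (h y hys) (ε / 3) (by positivity)] with i hi
  rw [dist_eq_norm] at hi ⊢
  have h1 := hf i x y
  have h2 := hg y x
  have h3 := norm_sub_le_norm_sub_add_norm_sub (f i x) (f i y) (g x)
  have h4 := norm_sub_le_norm_sub_add_norm_sub (f i y) (g y) (g x)
  rw [norm_sub_rev x y] at h1
  linarith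

end InnerAutomorphisms

/-! ### Approximate unitary equivalence of endomorphisms -/

section ApproximateEquivalence

variable {D : Type u} [CStarAlgebra D]

/-- Approximate unitary equivalence of unital endomorphisms, in the form with finite sets and
tolerances, which makes sense without separability. -/
def ApproxEquiv (β γ : D →⋆ₐ[ℂ] D) : Prop :=
  ∀ F : Finset D, ∀ ε > 0, ∃ u : unitary D, ∀ d ∈ F, ‖innerAut u (β d) - γ d‖ < ε

theorem ApproxEquiv.symm {β γ : D →⋆ₐ[ℂ] D} (h : ApproxEquiv β γ) : ApproxEquiv γ β := by
  intro F ε hε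
  obtain ⟨u, hu⟩ := h F ε hε
  exact ⟨u⁻¹, fun d hd => by rw [norm_innerAut_inv_sub]; exact hu d hd⟩

theorem ApproxEquiv.trans {β γ δ : D →⋆ₐ[ℂ] D} (h : ApproxEquiv β γ) (h' : ApproxEquiv γ δ) :
    ApproxEquiv β δ := by
  intro F ε hε
  obtain ⟨u, hu⟩ := h F (ε / 2) (half_pos hε)
  obtain ⟨v, hv⟩ := h' F (ε / 2) (half_pos hε)
  refine ⟨v * u, fun d hd => ?_⟩
  rw [innerAut_mul_apply]
  have := norm_innerAut_sub_le_add (u := v) (x := innerAut u (β d)) (y := γ d) (z := δ d)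
  linarith [hu d hd, hv d hd]

theorem ApproxEquiv.comp_left {β γ : D →⋆ₐ[ℂ] D} (h : ApproxEquiv β γ) (α : D →⋆ₐ[ℂ] D) :
    ApproxEquiv (α.comp β) (α.comp γ) := by
  intro F ε hε
  obtain ⟨u, hu⟩ := h F ε hε
  refine ⟨unitaryMap α u, fun d hd => ?_⟩
  rw [StarAlgHom.comp_apply, StarAlgHom.comp_apply, ← map_innerAut]
  exact (norm_starAlgHom_sub_le α _ _).trans_lt (hu d hd)

theorem ApproxEquiv.comp_right {β γ : D →⋆ₐ[ℂ] D} (h : ApproxEquiv β γ) (α : D →⋆ₐ[ℂ] D) :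
    ApproxEquiv (β.comp α) (γ.comp α) := by
  classical
  intro F ε hε
  obtain ⟨u, hu⟩ := h (F.image α) ε hε
  exact ⟨u, fun d hd => hu _ (Finset.mem_image_of_mem α hd)⟩

end ApproximateEquivalence

/-! ### The tensor square inside the algebra -/

section SelfTensor

variable {D : Type u} [CStarAlgebra D]

/-- An identification of `D` with its minimal tensor square, described inside `D`: the commuting
embeddings `left : d ↦ d ⊗ 1` and `right : d ↦ 1 ⊗ d`, the endomorphisms `map α = α ⊗ id`, and the
flip. The last field says that the first factor embedding is approximately inner. -/
structure SelfTensor (D : Type u) [CStarAlgebra D] where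
  /-- the embedding `d ↦ d ⊗ 1` -/
  left : D →⋆ₐ[ℂ] D
  /-- the embedding `d ↦ 1 ⊗ d` -/
  right : D →⋆ₐ[ℂ] D
  commute : ∀ a b, Commute (left a) (right b)
  dense : Dense (Submodule.span ℂ (Set.range fun p : D × D => left p.1 * right p.2) : Set D)
  /-- the endomorphism `α ⊗ id` -/
  map : (D →⋆ₐ[ℂ] D) → D →⋆ₐ[ℂ] D
  map_left : ∀ α a, map α (left a) = left (α a)
  map_right : ∀ α b, map α (right b) = right b
  /-- the flip `a ⊗ b ↦ b ⊗ a` -/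
  flip : D →⋆ₐ[ℂ] D
  flip_left : ∀ a, flip (left a) = right a
  flip_right : ∀ b, flip (right b) = left b
  id_approxEquiv_left : ApproxEquiv (StarAlgHom.id ℂ D) left

theorem nonempty_selfTensor (hD : IsStronglySelfAbsorbing D) : Nonempty (SelfTensor D) := by
  obtain ⟨φ, w, hw⟩ := hD.exists_iso
  let ψ : MinTensor D D →⋆ₐ[ℂ] D := (φ.symm : MinTensor D D →⋆ₐ[ℂ] D)
  let φ' : D →⋆ₐ[ℂ] MinTensor D D := (φ : D →⋆ₐ[ℂ] MinTensor D D)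
  let r : D →⋆ₐ[ℂ] MinTensor D D := (MinTensor.flip D D).comp (MinTensor.inclLeft D D)
  have hφψ : ∀ x, φ' (ψ x) = x := φ.apply_symm_apply
  have hψφ : ∀ x, ψ (φ' x) = x := φ.symm_apply_apply
  have hl : ∀ a, MinTensor.inclLeft D D a = MinTensor.ofTensor (a ⊗ₜ[ℂ] (1 : D)) := fun _ => rfl
  have hr : ∀ b, r b = MinTensor.ofTensor ((1 : D) ⊗ₜ[ℂ] b) := fun b => MinTensor.flip_tmul b 1
  have hlr : ∀ a b, MinTensor.inclLeft D D a * r b = MinTensor.ofTensor (a ⊗ₜ[ℂ] b) := by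
    intro a b
    rw [hl, hr, ← map_mul, Algebra.TensorProduct.tmul_mul_tmul, one_mul, mul_one]
  have hrl : ∀ a b, r b * MinTensor.inclLeft D D a = MinTensor.ofTensor (a ⊗ₜ[ℂ] b) := by
    intro a b
    rw [hl, hr, ← map_mul, Algebra.TensorProduct.tmul_mul_tmul, one_mul, mul_one]
  refine ⟨{
    left := ψ.comp (MinTensor.inclLeft D D)
    right := ψ.comp r
    commute := fun a b => ?_
    dense := ?_
    map := fun α => (ψ.comp (MinTensor.map α (StarAlgHom.id ℂ D))).comp φ'
    map_left := fun α a => ?_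
    map_right := fun α b => ?_
    flip := (ψ.comp (MinTensor.flip D D)).comp φ'
    flip_left := fun a => ?_
    flip_right := fun b => ?_
    id_approxEquiv_left := fun F ε hε => ?_ }⟩
  · change ψ _ * ψ _ = ψ _ * ψ _
    rw [← map_mul, ← map_mul]
    exact congrArg ψ ((hlr a b).trans (hrl a b).symm)
  · have hd : DenseRange fun x : D ⊗[ℂ] D => ψ (MinTensor.ofTensor x) :=
      (Function.Surjective.denseRange fun x => ⟨φ' x, hψφ x⟩).comp
        MinTensor.denseRange_ofTensor (continuous_starAlgHom ψ)
    refine hd.mono ?_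
    rintro _ ⟨x, rfl⟩
    induction x with
    | zero => simp
    | add x y hx hy => 
      simp only [map_add]
      exact add_mem (S := Submodule ℂ D) hx hy
    | tmul a b =>
      refine Submodule.subset_span ⟨(a, b), ?_⟩
      change ψ _ * ψ _ = ψ _
      rw [← map_mul]
      exact congrArg ψ (hlr a b)
  · simp only [StarAlgHom.comp_apply, hφψ, hl, MinTensor.map_tmul, map_one]
  · simp only [StarAlgHom.comp_apply, hφψ, hr, MinTensor.map_tmul, map_one]
    rfl
  · simp only [StarAlgHom.comp_apply, hφψ]
    rfl
  · simp only [StarAlgHom.comp_apply, hφψ, hr, hl, MinTensor.flip_tmul]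
  · have h : ∀ᶠ n in Filter.atTop, ∀ d ∈ F,
        ‖(w n : MinTensor D D) * φ' d * star (w n : MinTensor D D) -
          MinTensor.inclLeft D D d‖ < ε :=
      (Filter.eventually_all_finset F).2 fun d _ => (hw d).eventually (gt_mem_nhds hε)
    obtain ⟨n, hn⟩ := h.exists
    refine ⟨unitaryMap ψ (w n), fun d hd => ?_⟩
    have e : innerAut (unitaryMap ψ (w n)) d = ψ (innerAut (w n) (φ' d)) := by
      rw [map_innerAut, hψφ]
    change ‖innerAut (unitaryMap ψ (w n)) d - _‖ < ε
    rw [e, StarAlgHom.comp_apply]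
    exact (norm_starAlgHom_sub_le ψ _ _).trans_lt (hn d hd)

namespace SelfTensor

/-- Every unital endomorphism is approximately inner. In the monoid of endomorphisms modulo
approximate unitary equivalence `left` is trivial, so `α ⊗ id ~ α` (compose with `left`), and `right`
equals the flip, which is an involution; since `α ⊗ id` fixes `right`, the class of `α` is
trivial. -/
theorem approxEquiv_id (T : SelfTensor D) (α : D →⋆ₐ[ℂ] D) : ApproxEquiv α (StarAlgHom.id ℂ D) := by
  have hl := T.id_approxEquiv_left
  have hmap : ApproxEquiv (T.map α) α := by
    have h1 : (T.map α).comp T.left = T.left.comp α := StarAlgHom.ext fun a => T.map_left α a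
    have h2 := hl.comp_left (T.map α)
    have h3 := hl.symm.comp_right α
    rw [h1] at h2
    exact h2.trans h3
  have hflip : ApproxEquiv T.flip T.right := by
    have h1 : T.flip.comp T.left = T.right := StarAlgHom.ext T.flip_left
    have h2 := hl.comp_left T.flip
    rwa [h1] at h2
  have hinv : ApproxEquiv (T.right.comp T.flip) (StarAlgHom.id ℂ D) := by
    have h1 : T.flip.comp T.right = T.left := StarAlgHom.ext T.flip_right
    have h2 := hflip.comp_left T.flip
    rw [h1] at h2
    exact (hflip.symm.comp_right T.flip).trans (h2.trans hl.symm)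
  have h1 : (T.map α).comp T.right = T.right := StarAlgHom.ext fun a => T.map_right α a
  have h2 : ApproxEquiv (α.comp T.right) T.right := by
    have := hmap.symm.comp_right T.right
    rwa [h1] at this
  exact ((hinv.symm.comp_left α).trans (h2.comp_right T.flip)).trans hinv

theorem approxEquiv (T : SelfTensor D) (β γ : D →⋆ₐ[ℂ] D) : ApproxEquiv β γ :=
  (T.approxEquiv_id β).trans (T.approxEquiv_id γ).symm

/-- Pointwise convergence of unital endomorphisms may be tested on the two tensor factors. -/
theorem tendsto_of_tendsto_left_right (T : SelfTensor D) {ι : Type*} {l : Filter ι} {f : ι → D →⋆ₐ[ℂ] D}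
    {g : D →⋆ₐ[ℂ] D}
    (hl : ∀ a, Filter.Tendsto (fun i => f i (T.left a)) l (nhds (g (T.left a))))
    (hr : ∀ b, Filter.Tendsto (fun i => f i (T.right b)) l (nhds (g (T.right b)))) (x : D) :
    Filter.Tendsto (fun i => f i x) l (nhds (g x)) := by
  have hspan : ∀ y ∈ Submodule.span ℂ (Set.range fun p : D × D => T.left p.1 * T.right p.2),
      Filter.Tendsto (fun i => f i y) l (nhds (g y)) := by
    intro y hy
    induction hy using Submodule.span_induction with
    | mem y hy =>
      obtain ⟨p, rfl⟩ := hy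
      simp only [map_mul]
      exact (hl p.1).mul (hr p.2)
    | zero => simp only [map_zero]; exact tendsto_const_nhds
    | add y z _ _ hy hz => simp only [map_add]; exact hy.add hz
    | smul c y _ hy => simp only [map_smul]; exact hy.const_smul c
  exact tendsto_of_dense (fun i => norm_starAlgHom_sub_le (f i)) (norm_starAlgHom_sub_le g) T.dense
    hspan x

end SelfTensor

end SelfTensor

/-! ### Commutators of unitaries and `K₁` -/

section Commutators

variable {A : Type u} [CStarAlgebra A]

/-- The rotation by the angle `θ`, as a unitary `2 × 2` matrix over `A`. -/
def rotationUnitary (A : Type u) [CStarAlgebra A] (θ : ℝ) : UnitaryMatrix A 2 :=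
  ⟨!![algebraMap ℝ A (Real.cos θ), -algebraMap ℝ A (Real.sin θ);
      algebraMap ℝ A (Real.sin θ), algebraMap ℝ A (Real.cos θ)], by
    have hs : ∀ r : ℝ, star (algebraMap ℝ A r) = algebraMap ℝ A r := fun r => by
      rw [← algebraMap_star_comm]; simp
    have h1 : algebraMap ℝ A (Real.cos θ) * algebraMap ℝ A (Real.cos θ) +
        algebraMap ℝ A (Real.sin θ) * algebraMap ℝ A (Real.sin θ) = 1 := by
      rw [← map_mul, ← map_mul, ← map_add, ← map_one (algebraMap ℝ A)]
      congr 1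
      nlinarith [Real.sin_sq_add_cos_sq θ]
    have h2 := (Algebra.commutes (Real.cos θ) (algebraMap ℝ A (Real.sin θ)))
    rw [Unitary.mem_iff]
    constructor <;> ext i j <;> fin_cases i <;> fin_cases j <;>
      simp [Matrix.mul_apply, Fin.sum_univ_two, Matrix.star_apply, hs, h1, h2, add_comm]⟩

theorem continuous_rotationUnitary : Continuous (rotationUnitary A) := by
  refine Continuous.subtype_mk (continuous_matrix fun i j => ?_) _
  have hc : Continuous fun θ : ℝ => algebraMap ℝ A (Real.cos θ) :=
    (continuous_algebraMap ℝ A).comp Real.continuous_cos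
  have hs : Continuous fun θ : ℝ => algebraMap ℝ A (Real.sin θ) :=
    (continuous_algebraMap ℝ A).comp Real.continuous_sin
  fin_cases i <;> fin_cases j
  · exact hc
  · exact hs.neg
  · exact hs
  · exact hc

theorem rotationUnitary_zero : rotationUnitary A 0 = 1 := by
  refine Subtype.ext (Matrix.ext fun i j => ?_)
  fin_cases i <;> fin_cases j <;> simp [rotationUnitary]

/-- The unitary `diag(u, 1)`. -/
def cornerUnitary : unitary A →* UnitaryMatrix A 2 :=
  (padUnitary one_le_two).comp (unitaryToMatrix A)

theorem coe_cornerUnitary (u : unitary A) :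
    (cornerUnitary u : Matrix (Fin 2) (Fin 2) A) = !![(u : A), 0; 0, 1] := by
  ext i j
  fin_cases i <;> fin_cases j <;>
    simp [cornerUnitary, padUnitary, padMatrix, unitaryToMatrix, Unitary.map]

/-- The rotation by a right angle moves `diag(v, 1)` to `diag(1, v)`, which commutes with
`diag(u, 1)`. -/
theorem commute_cornerUnitary_rotationUnitary (u v : unitary A) :
    cornerUnitary u * (rotationUnitary A (Real.pi / 2) * cornerUnitary v * (rotationUnitary A (Real.pi / 2))⁻¹) =
      rotationUnitary A (Real.pi / 2) * cornerUnitary v * (rotationUnitary A (Real.pi / 2))⁻¹ *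
        cornerUnitary u := by
  have h : ((rotationUnitary A (Real.pi / 2) * cornerUnitary v * (rotationUnitary A (Real.pi / 2))⁻¹ :
      UnitaryMatrix A 2) : Matrix (Fin 2) (Fin 2) A) = !![1, 0; 0, (v : A)] := by
    rw [← Unitary.star_eq_inv]
    simp only [Submonoid.coe_mul, Unitary.coe_star, coe_cornerUnitary]
    ext i j
    fin_cases i <;> fin_cases j <;>
      simp [rotationUnitary, Matrix.mul_apply, Fin.sum_univ_two, Matrix.star_apply]
  apply Subtype.ext
  refine (congrArg ((cornerUnitary u : Matrix (Fin 2) (Fin 2) A) * ·) h).trans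
    (Eq.trans ?_ (congrArg (· * (cornerUnitary u : Matrix (Fin 2) (Fin 2) A)) h).symm)
  rw [coe_cornerUnitary]
  ext i j
  fin_cases i <;> fin_cases j <;> simp [Matrix.mul_apply, Fin.sum_univ_two]

open scoped commutatorElement in
/-- If `A` is `K₁`-injective, then commutators of unitaries lie in the component of `1`: their class
in `K₁` vanishes, because `diag(⁅u, v⁆, 1)` is the start of the path `⁅diag(u, 1), R diag(v, 1) R⁻¹⁆`,
where the rotation `R` moves from `1` to a right angle, and this path ends at `1`. -/
theorem commutator_mem_connectedComponentOfOne (hK : IsKOneInjective A) (u v : unitary A) :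
    ⁅u, v⁆ ∈ Subgroup.connectedComponentOfOne (unitary A) := by
  have hpath : cornerUnitary ⁅u, v⁆ ∈ connectedComponent (1 : UnitaryMatrix A 2) := by
    let f : ℝ → UnitaryMatrix A 2 := fun θ =>
      ⁅cornerUnitary u, rotationUnitary A θ * cornerUnitary v * (rotationUnitary A θ)⁻¹⁆
    have hf : Continuous f := by
      have := continuous_rotationUnitary (A := A)
      simp only [f, commutatorElement_def]
      fun_prop
    have h0 : f 0 = cornerUnitary ⁅u, v⁆ := by
      simp only [f, rotationUnitary_zero, one_mul, inv_one, mul_one, map_commutatorElement]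
    have h1 : f (Real.pi / 2) = 1 :=
      commutatorElement_eq_one_iff_mul_comm.2 (commute_cornerUnitary_rotationUnitary u v)
    rw [← h0, ← h1]
    exact (isPreconnected_range hf).subset_connectedComponent ⟨_, rfl⟩ ⟨_, rfl⟩
  have hone : toKOne A (QuotientGroup.mk ⁅u, v⁆) = 1 := by
    let x := ComponentGroup.map (unitaryToMatrix A) (continuous_unitaryToMatrix A)
      (QuotientGroup.mk ⁅u, v⁆)
    have hx : kOneMap (A := A) 1 2 one_le_two x = 1 := (QuotientGroup.eq_one_iff _).2 hpath
    have h1 : (⟦⟨1, x⟩⟧ : DirectLimit (fun n => ComponentGroup (UnitaryMatrix A n))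
        (fun n m h => kOneMap (A := A) n m h)) = ⟦⟨2, kOneMap (A := A) 1 2 one_le_two x⟩⟧ :=
      DirectLimit.eq_of_le (f := fun n m h => kOneMap (A := A) n m h) _ _ one_le_two
    refine h1.trans ?_
    rw [hx]
    exact (DirectLimit.one_def (f := fun n m h => kOneMap (A := A) n m h) 2).symm
  exact (QuotientGroup.eq_one_iff _).1 (hK (hone.trans (map_one _).symm))

end Commutators

/-! ### The basic homotopy lemma -/

section BasicHomotopy

variable {D : Type u} [CStarAlgebra D]

theorem mem_connectedComponentOfOne_of_norm_sub_lt_two {u v : unitary D}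
    (hu : u ∈ Subgroup.connectedComponentOfOne (unitary D)) (h : ‖(v : D) - u‖ < 2) :
    v ∈ Subgroup.connectedComponentOfOne (unitary D) := by
  have h1 : connectedComponent (1 : unitary D) = connectedComponent u := connectedComponent_eq hu
  change v ∈ connectedComponent (1 : unitary D)
  rw [h1]
  exact pathComponent_subset_component u (Unitary.joined u v h)

theorem joined_one_of_mem_connectedComponentOfOne {u : unitary D}
    (hu : u ∈ Subgroup.connectedComponentOfOne (unitary D)) : Joined 1 u := by
  have h : u ∈ connectedComponent (1 : unitary D) := hu
  rw [← pathComponent_eq_connectedComponent] at h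
  exact h

namespace SelfTensor

open scoped commutatorElement in
/-- If `v` implements `γ ≈ id`, then so does `v ⊗ v*` on the first tensor factor. This unitary is
close to a commutator, because `1 ⊗ v` is approximately conjugate to `v ⊗ 1`, so it lies in the
component of `1`; it is then moved back to `D`. -/
theorem exists_mem_component_innerAut_near (T : SelfTensor D) (hK : IsKOneInjective D)
    (γ : D →⋆ₐ[ℂ] D) (F : Finset D) {ε : ℝ} (hε : 0 < ε) :
    ∃ u ∈ Subgroup.connectedComponentOfOne (unitary D),
      ∀ d ∈ F, ‖innerAut u (γ d) - d‖ < ε := by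
  classical
  obtain ⟨v, hv⟩ := T.approxEquiv_id γ F (ε / 3) (by positivity)
  obtain ⟨w, hw⟩ := T.approxEquiv T.left T.right {(v : D)} 1 one_pos
  obtain ⟨z, hz⟩ := T.id_approxEquiv_left (F ∪ F.image γ) (ε / 3) (by positivity)
  let l := unitaryMap T.left v
  let r := unitaryMap T.right v
  have hmem : l * r⁻¹ ∈ Subgroup.connectedComponentOfOne (unitary D) := by
    refine mem_connectedComponentOfOne_of_norm_sub_lt_two
      (commutator_mem_connectedComponentOfOne hK l w) ?_
    have e1 : ((l * r⁻¹ : unitary D) : D) = (l : D) * star (r : D) := rfl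
    have e2 : ((⁅l, w⁆ : unitary D) : D) = (l : D) * star (innerAut w (l : D)) := by
      change (l : D) * (w : D) * star (l : D) * star (w : D) = _
      rw [Unitary.conjStarAlgAut_apply, star_mul, star_mul, star_star]
      simp only [mul_assoc]
    rw [e1, e2, ← mul_sub, ← star_sub, CStarRing.norm_coe_unitary_mul, norm_star, norm_sub_rev]
    exact (hw v (Finset.mem_singleton_self _)).trans one_lt_two
  have hconj : ∀ x, innerAut (l * r⁻¹) (T.left x) = T.left (innerAut v x) := by
    intro x
    have hc : Commute ((r⁻¹ : unitary D) : D) (T.left x) := by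
      change Commute (star (T.right (v : D))) (T.left x)
      rw [← map_star]
      exact (T.commute _ _).symm
    rw [innerAut_mul_apply, innerAut_eq_of_commute hc, map_innerAut]
  refine ⟨z⁻¹ * (l * r⁻¹) * z, ?_, fun d hd => ?_⟩
  · simpa using connectedComponentOfOne_normal.conj_mem _ hmem z⁻¹
  · have h1 : ‖innerAut z d - T.left d‖ < ε / 3 := hz d (Finset.mem_union_left _ hd)
    have h2 : ‖innerAut z (γ d) - T.left (γ d)‖ < ε / 3 :=
      hz (γ d) (Finset.mem_union_right _ (Finset.mem_image_of_mem γ hd))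
    have h3 : ‖T.left (innerAut v (γ d)) - T.left d‖ < ε / 3 :=
      (norm_starAlgHom_sub_le _ _ _).trans_lt (hv d hd)
    have h4 := norm_innerAut_sub_le_add (u := l * r⁻¹) (x := innerAut z (γ d))
      (y := T.left (γ d)) (z := innerAut z d)
    rw [hconj] at h4
    have h5 := norm_sub_le_norm_sub_add_norm_sub (T.left (innerAut v (γ d))) (T.left d)
      (innerAut z d)
    rw [norm_sub_rev (T.left d)] at h5
    rw [innerAut_mul_apply, innerAut_mul_apply, norm_innerAut_inv_sub, norm_sub_rev]
    linarith

end SelfTensor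

/-- The unitaries that commute with the elements of `F` up to `ε`. -/
def approxCentral (F : Finset D) (ε : ℝ) : Set (unitary D) :=
  {u | ∀ d ∈ F, ‖innerAut u d - d‖ < ε}

theorem approxCentral_subset {F G : Finset D} {ε δ : ℝ} (h : F ⊆ G) (h' : δ ≤ ε) :
    approxCentral G δ ⊆ approxCentral F ε := fun _ hu d hd => (hu d (h hd)).trans_le h'

theorem joinedIn_approxCentral {F : Finset D} {ε δ η : ℝ} {u v : unitary D} (hη : 0 < η)
    (hη' : η ≤ 1) (hF : ∀ d ∈ F, 2 * η * ‖d‖ ≤ ε - δ) (hu : u ∈ approxCentral F δ)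
    (huv : ‖(v : D) - u‖ < η) : JoinedIn (approxCentral F ε) u v := by
  have hball := Unitary.isPathConnected_ball u η hη (hη'.trans_lt one_lt_two)
  refine (hball.joinedIn u (Metric.mem_ball_self hη) v ?_).mono fun x hx d hd => ?_
  · rwa [Metric.mem_ball, Subtype.dist_eq, dist_eq_norm]
  · rw [Metric.mem_ball, Subtype.dist_eq, dist_eq_norm] at hx
    have h1 := norm_innerAut_sub_innerAut_le x u d
    have h2 := norm_sub_le_norm_sub_add_norm_sub (innerAut x d) (innerAut u d) d
    have h3 : 2 * ‖(x : D) - u‖ * ‖d‖ ≤ 2 * η * ‖d‖ := by gcongr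
    linarith [hu d hd, hF d hd]

theorem exists_pos_le_one_mul_norm_le (F : Finset D) {ε : ℝ} (hε : 0 < ε) :
    ∃ η : ℝ, 0 < η ∧ η ≤ 1 ∧ ∀ d ∈ F, 2 * η * ‖d‖ ≤ ε := by
  have hM : 0 ≤ ∑ d ∈ F, ‖d‖ := Finset.sum_nonneg fun _ _ => norm_nonneg _
  refine ⟨min 1 (ε / (2 * (1 + ∑ d ∈ F, ‖d‖))), by positivity, min_le_left _ _, fun d hd => ?_⟩
  have h1 : ‖d‖ ≤ ∑ d ∈ F, ‖d‖ := 
    Finset.single_le_sum (f := fun d : D => ‖d‖) (fun _ _ => norm_nonneg _) hd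
  have h2 := min_le_right 1 (ε / (2 * (1 + ∑ d ∈ F, ‖d‖)))
  calc _ ≤ 2 * (ε / (2 * (1 + ∑ d ∈ F, ‖d‖))) * (1 + ∑ d ∈ F, ‖d‖) := by
        gcongr
        linarith
    _ = ε := by field_simp

namespace SelfTensor

/-- If `u` approximately commutes with enough of `D`, then `u ⊗ 1` approximately commutes with a
prescribed element. -/
theorem exists_approxCentral_left (T : SelfTensor D) (x : D) {ε : ℝ} (hε : 0 < ε) :
    ∃ (G : Finset D) (δ : ℝ), 0 < δ ∧
      ∀ u ∈ approxCentral G δ, ‖innerAut (unitaryMap T.left u) x - x‖ < ε := by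
  classical
  let l : Filter (unitary D) :=
    { sets := {s | ∃ (G : Finset D) (δ : ℝ), 0 < δ ∧ approxCentral G δ ⊆ s}
      univ_sets := ⟨∅, 1, one_pos, Set.subset_univ _⟩
      sets_of_superset := fun ⟨G, δ, hδ, h⟩ hst => ⟨G, δ, hδ, h.trans hst⟩
      inter_sets := fun ⟨G, δ, hδ, h⟩ ⟨G', δ', hδ', h'⟩ =>
        ⟨G ∪ G', min δ δ', lt_min hδ hδ', Set.subset_inter
          ((approxCentral_subset Finset.subset_union_left (min_le_left _ _)).trans h)
          ((approxCentral_subset Finset.subset_union_right (min_le_right _ _)).trans h')⟩ }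
  have hl : ∀ a, Filter.Tendsto (fun u : unitary D => innerAut u a) l (nhds a) := fun a =>
    Metric.tendsto_nhds.2 fun r hr => ⟨{a}, r, hr, fun u hu => by
      change dist (innerAut u a) a < r
      rw [dist_eq_norm]; exact hu a (Finset.mem_singleton_self a)⟩
  have h := T.tendsto_of_tendsto_left_right (l := l) (g := StarAlgHom.id ℂ D)
    (f := fun u => (innerAut (unitaryMap T.left u) : D →⋆ₐ[ℂ] D))
    (fun a => (((continuous_starAlgHom T.left).tendsto a).comp (hl a)).congr fun u =>
      map_innerAut T.left u a)
    (fun b => tendsto_const_nhds.congr fun u => (innerAut_eq_of_commute (T.commute _ b)).symm) x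
  obtain ⟨G, δ, hδ, hG⟩ := Metric.tendsto_nhds.1 h ε hε
  refine ⟨G, δ, hδ, fun u hu => ?_⟩
  rw [← dist_eq_norm]
  exact hG hu

/-- The basic homotopy lemma: a unitary in the component of `1` that approximately commutes with
enough of `D` is joined to `1` by unitaries that approximately commute with `F`. If `u s` is any path
from `1` to `u`, then `u s ⊗ 1` commutes with `1 ⊗ F`, so its conjugate by a unitary `w` with
`w (d ⊗ 1) w* ≈ 1 ⊗ d` approximately commutes with `F ⊗ 1`. The path of conjugates ends near `u ⊗ 1`,
because `u ⊗ 1` approximately commutes with `w`. -/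
theorem exists_joinedIn_approxCentral (T : SelfTensor D) (F : Finset D) {ε : ℝ} (hε : 0 < ε) :
    ∃ (G : Finset D) (δ : ℝ), 0 < δ ∧
      ∀ u ∈ Subgroup.connectedComponentOfOne (unitary D), u ∈ approxCentral G δ →
        JoinedIn (approxCentral F ε) 1 u := by
  classical
  obtain ⟨η, hη, hη', hF⟩ := exists_pos_le_one_mul_norm_le F (half_pos hε)
  obtain ⟨w, hw⟩ := T.approxEquiv T.left T.right F (ε / 8) (by positivity)
  obtain ⟨G, δ, hδ, hG⟩ := T.exists_approxCentral_left (w : D) (half_pos hη)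
  refine ⟨G, δ, hδ, fun u hu huG => ?_⟩
  obtain ⟨z, hz⟩ := T.id_approxEquiv_left (insert (u : D) F) (min (η / 2) (ε / 8)) (by positivity)
  let g : unitary D → unitary D := fun v => z⁻¹ * (w⁻¹ * unitaryMap T.left v * w) * z
  have hg : Continuous g := by
    have := continuous_unitaryMap T.left
    fun_prop
  have hg1 : g 1 = 1 := by simp [g]
  have hgF : ∀ v, g v ∈ approxCentral F (ε / 2) := by
    intro v d hd
    have h1 : ‖innerAut z d - T.left d‖ < ε / 8 :=
      (hz d (Finset.mem_insert_of_mem hd)).trans_le (min_le_right _ _)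
    have h2 := norm_innerAut_sub_le_add (u := w) (x := innerAut z d) (y := T.left d)
      (z := T.right d)
    have h3 := norm_innerAut_sub_le_add (u := unitaryMap T.left v)
      (x := innerAut w (innerAut z d)) (y := T.right d) (z := innerAut w (innerAut z d))
    rw [innerAut_eq_of_commute (x := T.right d) (T.commute _ d), norm_sub_rev (T.right d)] at h3
    simp only [g, innerAut_mul_apply]
    rw [norm_innerAut_inv_sub, norm_sub_rev, norm_innerAut_inv_sub, norm_sub_rev]
    linarith [hw d hd]
  have hgu : ‖(u : D) - g u‖ < η := by
    have e : (g u : D) = innerAut z⁻¹ (innerAut w⁻¹ (T.left u)) := by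
      simp only [g, Unitary.conjStarAlgAut_apply, Submonoid.coe_mul, coe_unitaryMap,
        ← Unitary.star_eq_inv, Unitary.coe_star, star_star]
    have h1 : ‖innerAut z u - T.left u‖ < η / 2 :=
      (hz u (Finset.mem_insert_self _ _)).trans_le (min_le_left _ _)
    have h2 : ‖innerAut w⁻¹ (T.left u) - T.left u‖ < η / 2 := by
      have h := hG u huG
      rw [norm_innerAut_sub_self, coe_unitaryMap, norm_sub_rev] at h
      rw [norm_innerAut_inv_sub, norm_innerAut_sub_self]
      exact h
    have h3 := norm_sub_le_norm_sub_add_norm_sub (innerAut z u) (T.left u)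
      (innerAut w⁻¹ (T.left u))
    rw [norm_sub_rev (T.left _)] at h3
    rw [e, norm_sub_rev, norm_innerAut_inv_sub]
    linarith
  have hpath : JoinedIn (approxCentral F (ε / 2)) 1 (g u) := by
    have h := (joinedIn_univ.2 (joined_one_of_mem_connectedComponentOfOne hu)).map hg
    rw [hg1] at h
    refine h.mono ?_
    rintro _ ⟨v, -, rfl⟩
    exact hgF v
  exact (hpath.mono (approxCentral_subset subset_rfl (by linarith))).trans
    (joinedIn_approxCentral hη hη' (fun d hd => (hF d hd).trans (by linarith)) (hgF u) hgu)

end SelfTensor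

end BasicHomotopy

/-! ### Rays of unitaries -/

section UnitaryPaths

/-- Infinitely many paths in a topological group, joining the successive members of a sequence, are
concatenated to a ray that starts at `1`. -/
theorem exists_ray_of_joinedIn {M : Type*} [Group M] [TopologicalSpace M] [IsTopologicalGroup M]
    {w : ℕ → M} {S : ℕ → Set M} (h0 : Joined 1 (w 0))
    (h : ∀ n, JoinedIn (S n) 1 (w (n + 1) * (w n)⁻¹)) :
    ∃ W : ℝ → M, Continuous W ∧ W (-1) = 1 ∧
      ∀ (n : ℕ) (t : ℝ), n ≤ t → t ≤ n + 1 → ∃ s ∈ S n, W t = s * w n := by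
  obtain ⟨q⟩ := h0
  let p : ∀ n, Path 1 (w (n + 1) * (w n)⁻¹) := fun n => (h n).somePath
  -- the `n`-th partial concatenation, which is constant from time `n` on
  let G : ℕ → ℝ → M := fun n => Nat.rec (fun t => q.extend (t + 1))
    (fun n g t => (p n).extend (t - n) * g t) n
  have hGs : ∀ n t, G (n + 1) t = (p n).extend (t - n) * G n t := fun _ _ => rfl
  have hGc : ∀ n, Continuous (G n) := by
    intro n
    induction n with
    | zero => exact q.continuous_extend.comp (by fun_prop)
    | succ n ih => exact ((p n).continuous_extend.comp (by fun_prop)).mul ih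
  have hGn : ∀ (n : ℕ) (t : ℝ), n ≤ t → G n t = w n := by
    intro n
    induction n with
    | zero =>
      intro t ht
      exact q.extend_of_one_le (by push_cast at ht; linarith)
    | succ n ih =>
      intro t ht
      push_cast at ht
      rw [hGs, ih t (by linarith), (p n).extend_of_one_le (by linarith), inv_mul_cancel_right]
  have hst : ∀ (n m : ℕ) (t : ℝ), n ≤ m → t ≤ n → G m t = G n t := by
    intro n m t hnm ht
    induction m, hnm using Nat.le_induction with
    | base => rfl
    | succ m hm ih =>
      have : (n : ℝ) ≤ m := by exact_mod_cast hm
      rw [hGs, (p m).extend_of_le_zero (by linarith), one_mul, ih]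
  have hW : ∀ (n : ℕ) (t : ℝ), t ≤ n → G ⌈t⌉₊ t = G n t := fun n t ht =>
    (hst _ n t (Nat.ceil_le.2 ht) (Nat.le_ceil t)).symm
  refine ⟨fun t => G ⌈t⌉₊ t, ?_, ?_, fun n t hn ht => ?_⟩
  · refine continuous_iff_continuousAt.2 fun t => ?_
    refine (hGc (⌈t⌉₊ + 1)).continuousAt.congr ?_
    have ht : t < (⌈t⌉₊ + 1 : ℕ) := by push_cast; linarith [Nat.le_ceil t]
    filter_upwards [eventually_lt_nhds ht] with s hs
    exact (hW _ s hs.le).symm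
  · have : ⌈(-1 : ℝ)⌉₊ = 0 := by simp
    change G ⌈(-1 : ℝ)⌉₊ (-1) = 1
    rw [this]
    exact q.extend_of_le_zero (by norm_num)
  · refine ⟨(p n).extend (t - n), ?_, ?_⟩
    · exact (h n).somePath_mem _
    · change G ⌈t⌉₊ t = _
      rw [hW (n + 1) t (by push_cast; exact ht), hGs, hGn n t hn]

variable {D : Type u} [CStarAlgebra D]

/-- Every unital endomorphism of `D` is asymptotically inner, by a path of unitaries that starts at
`1`. -/
theorem SelfTensor.exists_unitary_ray (T : SelfTensor D) (hK : IsKOneInjective D)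
    [TopologicalSpace.SeparableSpace D] (γ : D →⋆ₐ[ℂ] D) :
    ∃ W : ℝ → unitary D, Continuous W ∧ W (-1) = 1 ∧
      ∀ d, Filter.Tendsto (fun t => innerAut (W t) (γ d)) Filter.atTop (nhds d) := by
  classical
  let e : ℕ → D := TopologicalSpace.denseSeq D
  let F : ℕ → Finset D := fun n => (Finset.range n).image e
  have hε : ∀ n : ℕ, (0 : ℝ) < 1 / (n + 1) := fun n => Nat.one_div_pos_of_nat
  choose G δ hδ hG using fun n => T.exists_joinedIn_approxCentral (F n) (hε n)
  -- `w n` serves the paths from `w (n - 1)` to `w n` and from `w n` to `w (n + 1)`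
  choose w hw0 hw using fun n => T.exists_mem_component_innerAut_near hK γ
    (F n ∪ (G n ∪ G (n - 1))) (lt_min (hε n) (lt_min (half_pos (hδ n)) (half_pos (hδ (n - 1)))))
  have hstep : ∀ n, w (n + 1) * (w n)⁻¹ ∈ approxCentral (G n) (δ n) := by
    intro n d hd
    have h1 : ‖innerAut (w n) (γ d) - d‖ < δ n / 2 :=
      (hw n d (by simp [hd])).trans_le ((min_le_right _ _).trans (min_le_left _ _))
    have h2 : ‖innerAut (w (n + 1)) (γ d) - d‖ < δ n / 2 :=
      (hw (n + 1) d (by simp [hd])).trans_le ((min_le_right _ _).trans (min_le_right _ _))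
    have h3 := norm_innerAut_sub_le_add (u := w (n + 1)) (x := innerAut (w n)⁻¹ d) (y := γ d)
      (z := d)
    rw [norm_innerAut_inv_sub] at h3
    rw [innerAut_mul_apply]
    linarith
  obtain ⟨W, hWc, hW1, hW⟩ := exists_ray_of_joinedIn
    (joined_one_of_mem_connectedComponentOfOne (hw0 0))
    fun n => hG n _ (mul_mem (hw0 (n + 1)) (inv_mem (hw0 n))) (hstep n)
  refine ⟨W, hWc, hW1, tendsto_of_dense (g := id) (s := Set.range e)
    (fun t x y => ?_) (fun _ _ => le_rfl) (TopologicalSpace.denseRange_denseSeq D) ?_⟩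
  · rw [norm_starAlgEquiv_sub]
    exact norm_starAlgHom_sub_le γ x y
  rintro _ ⟨k, rfl⟩
  rw [Metric.tendsto_nhds]
  intro ε hε'
  obtain ⟨N, hN⟩ := exists_nat_one_div_lt (half_pos hε')
  filter_upwards [Filter.eventually_ge_atTop ((max N (k + 1) : ℕ) : ℝ)] with t ht
  let n := ⌊t⌋₊
  have ht0 : 0 ≤ t := (Nat.cast_nonneg _).trans ht
  have hn : max N (k + 1) ≤ n := Nat.le_floor ht
  obtain ⟨s, hs, hst⟩ := hW n t (Nat.floor_le ht0) (Nat.lt_floor_add_one t).le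
  have hk : e k ∈ F n := Finset.mem_image_of_mem e
    (Finset.mem_range.2 ((le_max_right _ _).trans hn))
  have h1 : ‖innerAut (w n) (γ (e k)) - e k‖ < 1 / (n + 1) :=
    (hw n _ (Finset.mem_union_left _ hk)).trans_le (min_le_left _ _)
  have h2 : ‖innerAut s (e k) - e k‖ < 1 / (n + 1) := hs _ hk
  have h3 : (1 : ℝ) / (n + 1) ≤ 1 / (N + 1) :=
    Nat.one_div_le_one_div ((le_max_left _ _).trans hn)
  have h4 := norm_innerAut_sub_le_add (u := s) (x := innerAut (w n) (γ (e k))) (y := e k)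
    (z := e k)
  rw [dist_eq_norm, hst, innerAut_mul_apply, id]
  linarith

end UnitaryPaths

/-! ### The contraction of the automorphism group -/

section Contraction

open Filter Topology

variable {D : Type u} [CStarAlgebra D]

/-- The underlying `*`-homomorphism of an automorphism. -/
def CStarAut.toHom (α : CStarAut D) : D →⋆ₐ[ℂ] D :=
  let φ : D ≃⋆ₐ[ℂ] D := α
  (φ : D →⋆ₐ[ℂ] D)

/-- The identity automorphism. -/
def CStarAut.refl (D : Type u) [CStarAlgebra D] : CStarAut D := StarAlgEquiv.refl ℂ D

/-- The automorphism `x ↦ u (α x) u*`. -/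
def CStarAut.conj (u : unitary D) (α : CStarAut D) : CStarAut D :=
  StarAlgEquiv.trans (B := D) α (innerAut u)

theorem CStarAut.refl_toHom_apply (d : D) : (CStarAut.refl D).toHom d = d := rfl

theorem CStarAut.conj_toHom_apply (u : unitary D) (α : CStarAut D) (d : D) :
    (CStarAut.conj u α).toHom d = innerAut u (α.toHom d) := rfl

theorem CStarAut.continuous_iff {X : Type*} [TopologicalSpace X] {f : X → CStarAut D} :
    Continuous f ↔ ∀ d, Continuous fun x => (f x).toHom d :=
  continuous_induced_rng.trans
    (continuous_pi_iff (f := fun x (d : D) => (f x).toHom d))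

theorem CStarAut.continuous_toHom_apply (d : D) : Continuous fun α : CStarAut D => α.toHom d :=
  CStarAut.continuous_iff.1 continuous_id d

namespace SelfTensor

variable (T : SelfTensor D)

/-- The map `(α, x) ↦ (α ⊗ id) x` is jointly continuous in the point-norm topology. -/
theorem continuous_map_apply :
    Continuous fun p : D × CStarAut D => T.map p.2.toHom p.1 := by
  refine continuous_prod_of_continuous_lipschitzWith _ 1 (fun x => ?_) fun α =>
    LipschitzWith.of_dist_le_mul fun x y => ?_
  · refine continuous_iff_continuousAt.2 fun α₀ => T.tendsto_of_tendsto_left_right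
      (f := fun α : CStarAut D => T.map α.toHom) (g := T.map α₀.toHom) (fun a => ?_)
      (fun b => ?_) x
    · simp only [T.map_left]
      exact ((continuous_starAlgHom T.left).comp (CStarAut.continuous_toHom_apply a)).tendsto α₀
    · simp only [T.map_right]
      exact tendsto_const_nhds
  · rw [dist_eq_norm, dist_eq_norm, NNReal.coe_one, one_mul]
    exact norm_starAlgHom_sub_le _ x y

/-- The unitary `v (α ⊗ id)(v* y) y*`. If `y` conjugates `d ⊗ 1` to `d` and `v` conjugates `1 ⊗ d` to
`d`, then it conjugates `α d` to `d`, by way of `α d ⊗ 1 = (α ⊗ id)(d ⊗ 1)` and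
`1 ⊗ d = (α ⊗ id)(1 ⊗ d)`. -/
def untwist (v y : unitary D) (α : CStarAut D) : unitary D :=
  v * unitaryMap (T.map α.toHom) (v⁻¹ * y) * y⁻¹

theorem untwist_one (α : CStarAut D) : T.untwist 1 1 α = 1 := by
  simp only [untwist, inv_one, mul_one, map_one]

theorem continuous_untwist {X : Type*} [TopologicalSpace X] {v y : X → unitary D}
    {α : X → CStarAut D} (hv : Continuous v) (hy : Continuous y) (hα : Continuous α) :
    Continuous fun x => T.untwist (v x) (y x) (α x) := by
  have h : Continuous fun x => unitaryMap (T.map (α x).toHom) ((v x)⁻¹ * y x) :=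
    (T.continuous_map_apply.comp
      ((continuous_subtype_val.comp (hv.inv.mul hy)).prodMk hα)).subtype_mk _
  exact (hv.mul h).mul hy.inv

theorem norm_innerAut_untwist_sub_le (v y : unitary D) (α α₀ : CStarAut D) (d : D) :
    ‖innerAut (T.untwist v y α) (α.toHom d) - d‖ ≤
      2 * ‖α.toHom d - α₀.toHom d‖ + ‖innerAut y (T.left (α₀.toHom d)) - α₀.toHom d‖ +
        ‖innerAut y (T.left d) - d‖ + 2 * ‖innerAut v (T.right d) - d‖ := by
  have h1 := norm_innerAut_sub_le_add (u := v)
    (x := innerAut (unitaryMap (T.map α.toHom) (v⁻¹ * y)) (innerAut y⁻¹ (α.toHom d)))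
    (y := T.right d) (z := d)
  have h2 := norm_innerAut_sub_le_add (u := unitaryMap (T.map α.toHom) (v⁻¹ * y))
    (x := innerAut y⁻¹ (α.toHom d)) (y := T.left (α.toHom d)) (z := T.right d)
  have h3 : ‖innerAut (unitaryMap (T.map α.toHom) (v⁻¹ * y)) (T.left (α.toHom d)) - T.right d‖ ≤
      ‖innerAut v (T.right d) - d‖ + ‖innerAut y (T.left d) - d‖ := by
    rw [← T.map_left, ← map_innerAut]
    nth_rw 1 [← T.map_right α.toHom d]
    refine (norm_starAlgHom_sub_le _ _ _).trans ?_
    rw [innerAut_mul_apply, norm_innerAut_inv_sub, norm_sub_rev (innerAut y _)]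
    exact norm_sub_le_norm_sub_add_norm_sub _ _ _
  have h4 : ‖innerAut y⁻¹ (α.toHom d) - T.left (α.toHom d)‖ ≤
      2 * ‖α.toHom d - α₀.toHom d‖ + ‖innerAut y (T.left (α₀.toHom d)) - α₀.toHom d‖ := by
    rw [norm_innerAut_inv_sub]
    have h5 := norm_innerAut_sub_le_add (u := y) (x := T.left (α.toHom d))
      (y := T.left (α₀.toHom d)) (z := α.toHom d)
    have h6 := norm_starAlgHom_sub_le T.left (α.toHom d) (α₀.toHom d)
    have h7 := norm_sub_le_norm_sub_add_norm_sub (innerAut y (T.left (α₀.toHom d))) (α₀.toHom d)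
      (α.toHom d)
    rw [norm_sub_rev (α₀.toHom d)] at h7
    linarith
  rw [untwist, innerAut_mul_apply, innerAut_mul_apply]
  linarith

end SelfTensor

theorem tendsto_one_div_one_sub_atTop :
    Tendsto (fun t : ℝ => 1 / (1 - t) - 2) (𝓝[<] 1) atTop := by
  have h1 : Tendsto (fun t : ℝ => 1 - t) (𝓝[<] 1) (𝓝[>] 0) := by
    refine tendsto_nhdsWithin_iff.2 ⟨?_, ?_⟩
    · have : Tendsto (fun t : ℝ => 1 - t) (𝓝 1) (𝓝 (1 - 1)) :=
        (continuous_const.sub continuous_id).tendsto 1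
      rw [sub_self] at this
      exact this.mono_left nhdsWithin_le_nhds
    · filter_upwards [self_mem_nhdsWithin] with t ht
      exact sub_pos.2 (Set.mem_Iio.1 ht)
  simp only [one_div, sub_eq_add_neg _ (2 : ℝ)]
  exact tendsto_atTop_add_const_right _ _ (tendsto_inv_nhdsGT_zero.comp h1)

/-- The automorphism group is contractible: conjugation by the unitaries `untwist (V t) (Y t) α`,
where `Y` and `V` are rays of unitaries that asymptotically undo the two factor embeddings, deforms
`α` to the identity as `t → ∞`, continuously in `α`. -/
theorem homotopic_id_const_cstarAut [TopologicalSpace.SeparableSpace D]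
    (hD : IsStronglySelfAbsorbing D) (hK : IsKOneInjective D) :
    (ContinuousMap.id (CStarAut D)).Homotopic
      (ContinuousMap.const _ (CStarAut.refl D)) := by
  classical
  obtain ⟨T⟩ := nonempty_selfTensor hD
  obtain ⟨Y, hYc, hY1, hY⟩ := T.exists_unitary_ray hK T.left
  obtain ⟨V, hVc, hV1, hV⟩ := T.exists_unitary_ray hK T.right
  -- the parameter runs from `-1`, where both rays start, to infinity
  let s : ℝ → ℝ := fun t => 1 / (1 - t) - 2
  let H : unitInterval × CStarAut D → CStarAut D := fun p =>
    if (p.1 : ℝ) = 1 then CStarAut.refl D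
    else CStarAut.conj (T.untwist (V (s p.1)) (Y (s p.1)) p.2) p.2
  have hH1 : ∀ p : unitInterval × CStarAut D, (p.1 : ℝ) = 1 → H p = CStarAut.refl D :=
    fun p hp => if_pos hp
  have hH : ∀ p : unitInterval × CStarAut D, (p.1 : ℝ) ≠ 1 →
      H p = CStarAut.conj (T.untwist (V (s p.1)) (Y (s p.1)) p.2) p.2 :=
    fun p hp => if_neg hp
  have hcont : Continuous H := by
    refine CStarAut.continuous_iff.2 fun d => continuous_iff_continuousAt.2 fun p₀ => ?_
    have hfst : Continuous fun p : unitInterval × CStarAut D => (p.1 : ℝ) :=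
      continuous_subtype_val.comp continuous_fst
    by_cases hp₀ : (p₀.1 : ℝ) = 1
    · have hα := (CStarAut.continuous_toHom_apply d).comp
        (continuous_snd (X := unitInterval) (Y := CStarAut D))
      have hnear : Tendsto (fun p : unitInterval × CStarAut D =>
          2 * ‖p.2.toHom d - p₀.2.toHom d‖) (𝓝 p₀) (𝓝 0) := by
        have : Continuous fun p : unitInterval × CStarAut D =>
            2 * ‖p.2.toHom d - p₀.2.toHom d‖ :=
          continuous_const.mul (hα.sub continuous_const).norm
        simpa using this.tendsto p₀
      have htail : Tendsto (fun t => ‖innerAut (Y t) (T.left (p₀.2.toHom d)) - p₀.2.toHom d‖ +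
          ‖innerAut (Y t) (T.left d) - d‖ + 2 * ‖innerAut (V t) (T.right d) - d‖) atTop (𝓝 0) := by
        simpa using ((tendsto_iff_norm_sub_tendsto_zero.1 (hY (p₀.2.toHom d))).add
          (tendsto_iff_norm_sub_tendsto_zero.1 (hY d))).add
          ((tendsto_iff_norm_sub_tendsto_zero.1 (hV d)).const_mul 2)
      refine Metric.tendsto_nhds.2 fun ε hε => ?_
      have h1 := eventually_nhdsWithin_iff.1
        ((htail.comp tendsto_one_div_one_sub_atTop).eventually (gt_mem_nhds (half_pos hε)))
      filter_upwards [(hfst.tendsto' p₀ 1 hp₀).eventually h1,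
        hnear.eventually (gt_mem_nhds (half_pos hε))] with p hp hp'
      rw [dist_eq_norm, hH1 p₀ hp₀, CStarAut.refl_toHom_apply]
      rcases eq_or_ne (p.1 : ℝ) 1 with h | h
      · rw [hH1 p h, CStarAut.refl_toHom_apply, sub_self, norm_zero]
        exact hε
      · have h2 := hp (lt_of_le_of_ne p.1.2.2 h)
        rw [hH p h, CStarAut.conj_toHom_apply]
        have h3 := T.norm_innerAut_untwist_sub_le (V (s p.1)) (Y (s p.1)) p.2 p₀.2 d
        simp only [Function.comp_apply] at h2
        linarith
    · have hev : ∀ᶠ p in 𝓝 p₀, ((p : unitInterval × CStarAut D).1 : ℝ) ≠ 1 :=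
        hfst.continuousAt.eventually_ne hp₀
      have hU : Continuous fun q : ℝ × CStarAut D =>
          innerAut (T.untwist (V q.1) (Y q.1) q.2) (q.2.toHom d) :=
        continuous_innerAut_apply (T.continuous_untwist (hVc.comp continuous_fst)
          (hYc.comp continuous_fst) continuous_snd)
          ((CStarAut.continuous_toHom_apply d).comp continuous_snd)
      have hs : ContinuousAt (fun p : unitInterval × CStarAut D => (s p.1, p.2)) p₀ :=
        ((continuousAt_const.div (continuousAt_const.sub hfst.continuousAt)
          (sub_ne_zero.2 (Ne.symm hp₀))).sub continuousAt_const).prodMk continuousAt_snd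
      refine (hU.continuousAt.comp hs).congr (hev.mono fun p hp => ?_)
      dsimp only
      rw [hH p hp, CStarAut.conj_toHom_apply]
      rfl
  refine ⟨⟨⟨H, hcont⟩, fun α => ?_, fun α => ?_⟩⟩
  · have h0 : ((0 : unitInterval) : ℝ) = 0 := rfl
    have h1 : s 0 = -1 := by norm_num [s]
    refine (hH (0, α) (by rw [h0]; norm_num)).trans ?_
    rw [h0, h1, hV1, hY1, T.untwist_one]
    exact StarAlgEquiv.ext fun d => innerAut_one_apply _
  · exact hH1 (1, α) rfl

end Contraction

end

theorem corollary2p1 (D : Type u) [CStarAlgebra D] [TopologicalSpace.SeparableSpace D]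
    (hD : IsStronglySelfAbsorbing D) (hK : IsKOneInjective D)
    (X : Type v) [TopologicalSpace X] [CompactSpace X] [T2Space X] :
    Nonempty (Unique (HomotopyClasses X (CStarAut D))) := by
  have h : ∀ f : C(X, CStarAut D),
      f.Homotopic (ContinuousMap.const X (CStarAut.refl D)) := fun f =>
    (homotopic_id_const_cstarAut hD hK).comp (ContinuousMap.Homotopic.refl f)
  exact ⟨⟨⟨Quotient.mk _ (ContinuousMap.const X (CStarAut.refl D))⟩,
    fun q => Quotient.inductionOn q fun f => Quotient.sound (h f)⟩⟩
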